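/- Let $n>2$, let $(M,g)$ be a smooth $n$-dimensional Lorentzian manifold of signature $(-,+,\dots,+)$ with Levi-Civita connection $\nabla$, and let $\Delta$ be a smooth $(n-1)$-dimensional (embedded or, more generally, immersed) submanifold of $M$ which is null: at every $x\in\Delta$ the pullback $q_{ab}$ of $g$ to $T_x\Delta$ is degenerate. Let $L_x\subset T_x\Delta$ denote the degeneracy subspace of $q$. For a smooth (local) null vector field $\ell$ on and tangent to $\Delta$, let $\nabla_a\ell_b$ be the pullback to $\Delta$ of $\nabla_\alpha\ell_\beta$, that is, the tensor $(X,Y)\mapsto g(\nabla_X\ell,Y)$ for $X,Y$ tangent to $\Delta$. The tensors $q_{ab}$ and $\nabla_a\ell_b$ descend to tensors on $T_x\Delta/L_x$, the first one to a positive definite metric; the expansion $\theta^{(\ell)}$ is the trace of the second one with respect to this metric. Assume that $\Delta$ is non-expanding: for every $x\in\Delta$ there is a null vector field $\ell$, defined on a neighbourhood of $x$ in $\Delta$, tangent to $\Delta$ and non-zero at $x$, with $\theta^{(\ell)}(x)=0$. Assume that at all points of $\Delta$ the Einstein equations $$R_{\alpha\beta}-\tfrac12 R\,g_{\alpha\beta}=-\Lambda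 g_{\alpha\beta}+T_{\alpha\beta}$$ hold, with a constant $\Lambda\in\mathbb{R}$ and a tensor field $T_{\alpha\beta}$ such that $T_{\alpha\beta}\ell^\alpha\ell^\beta\ge0$ for every null vector $\ell$ tangent to $\Delta$. (The sign convention of the Ricci tensor $R_{\alpha\beta}$ is the one in which round spheres have positive Ricci curvature.) Then: 1. $\Delta$ is shear-free: for every smooth null vector field $\ell$ defined on (an open subset of) $\Delta$ and tangent to $\Delta$, $\nabla_a\ell_b=0$; 2. the induced degenerate metric is Lie-dragged by every such $\ell$: $\mathcal{L}_\ell q_{ab}=0$; 3. $R_{\alpha\beta}\ell^\alpha\ell^\beta=0$ at every point of $\Delta$, for every null vector $\ell$ tangent to $\Delta$. -/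

import Mathlib

open Set Bundle Module
open scoped Manifold ContDiff

noncomputable section

/-! ### Riemannian tensor calculus in coordinates on `ℝⁿ`

`G u` is the matrix `(g_{ij})` of a metric in coordinates at the point with coordinates `u`. -/

/-- The partial derivative `∂ᵢ f` of a function of `n` real coordinates. -/
def partialDeriv {n : ℕ} (i : Fin n) (f : EuclideanSpace ℝ (Fin n) → ℝ)
    (u : EuclideanSpace ℝ (Fin n)) : ℝ :=
  fderiv ℝ f u (EuclideanSpace.single i 1)

/-- The Christoffel symbols
`Γᵏᵢⱼ = ½ ∑ₗ gᵏˡ (∂ᵢ g_{jl} + ∂ⱼ g_{il} - ∂ₗ g_{ij})`; `christoffel G k i j u = Γᵏᵢⱼ(u)`. -/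
def christoffel {n : ℕ} (G : EuclideanSpace ℝ (Fin n) → Matrix (Fin n) (Fin n) ℝ)
    (k i j : Fin n) (u : EuclideanSpace ℝ (Fin n)) : ℝ :=
  (1 / 2) * ∑ l, (G u)⁻¹ k l *
    (partialDeriv i (fun w => G w j l) u + partialDeriv j (fun w => G w i l) u
      - partialDeriv l (fun w => G w i j) u)

/-- The components of the Riemann tensor, `riemannCoord G k l i j = Rᵏ_{l i j}`, with the
convention `[∇ᵢ, ∇ⱼ] Xᵏ = Rᵏ_{l i j} Xˡ`. -/
def riemannCoord {n : ℕ} (G : EuclideanSpace ℝ (Fin n) → Matrix (Fin n) (Fin n) ℝ)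
    (k l i j : Fin n) (u : EuclideanSpace ℝ (Fin n)) : ℝ :=
  partialDeriv i (christoffel G k j l) u - partialDeriv j (christoffel G k i l) u
    + ∑ m, (christoffel G k i m u * christoffel G m j l u
      - christoffel G k j m u * christoffel G m i l u)

/-- The components `R_{lj} = Rᵏ_{l k j}` of the Ricci tensor. -/
def ricciCoord {n : ℕ} (G : EuclideanSpace ℝ (Fin n) → Matrix (Fin n) (Fin n) ℝ)
    (l j : Fin n) (u : EuclideanSpace ℝ (Fin n)) : ℝ :=
  ∑ k, riemannCoord G k l k j u

/-- The scalar curvature `R = g^{lj} R_{lj}`. -/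
def scalarCurvatureCoord {n : ℕ} (G : EuclideanSpace ℝ (Fin n) → Matrix (Fin n) (Fin n) ℝ)
    (u : EuclideanSpace ℝ (Fin n)) : ℝ :=
  ∑ l, ∑ j, (G u)⁻¹ l j * ricciCoord G l j u

/-! ### Coordinates on a manifold -/

section Coordinates

variable {n : ℕ} {M : Type*} [TopologicalSpace M] [ChartedSpace (EuclideanSpace ℝ (Fin n)) M]

/-- The components, in the preferred chart around `c`, of a tangent vector `v` at `x`
(for `x` in the domain of that chart). -/
def vecCoord (c x : M) (v : TangentSpace (𝓡 n) x) : EuclideanSpace ℝ (Fin n) :=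
  mfderiv (𝓡 n) 𝓘(ℝ, EuclideanSpace ℝ (Fin n)) (extChartAt (𝓡 n) c) x v

/-- The `i`-th coordinate vector `∂ᵢ` of the preferred chart around `c`, at the point with
coordinates `u`. -/
def coordVec (c : M) (u : EuclideanSpace ℝ (Fin n)) (i : Fin n) :
    TangentSpace (𝓡 n) ((extChartAt (𝓡 n) c).symm u) :=
  mfderiv 𝓘(ℝ, EuclideanSpace ℝ (Fin n)) (𝓡 n) (extChartAt (𝓡 n) c).symm u
    (EuclideanSpace.single i (1 : ℝ) : EuclideanSpace ℝ (Fin n))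

/-- The matrix of components `h(∂ᵢ, ∂ⱼ)` of a field `h` of bilinear forms in the preferred chart
around `c`, as a function of the coordinates. -/
def formCoord (h : ∀ x : M, TangentSpace (𝓡 n) x →L[ℝ] TangentSpace (𝓡 n) x →L[ℝ] ℝ) (c : M)
    (u : EuclideanSpace ℝ (Fin n)) : Matrix (Fin n) (Fin n) ℝ :=
  Matrix.of fun i j => h ((extChartAt (𝓡 n) c).symm u) (coordVec c u i) (coordVec c u j)

/-- The Lie derivative `(ℒ_ℓ h)(X, Y)` at `p` of a field `h` of bilinear forms along a vector
field `ℓ`, in coordinates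
`(ℒ_ℓ h)_{ab} = ℓᶜ ∂_c h_{ab} + h_{cb} ∂_a ℓᶜ + h_{ac} ∂_b ℓᶜ`. -/
def lieDerivForm (h : ∀ x : M, TangentSpace (𝓡 n) x →L[ℝ] TangentSpace (𝓡 n) x →L[ℝ] ℝ)
    (ℓ : ∀ x : M, TangentSpace (𝓡 n) x) (p : M) (X Y : TangentSpace (𝓡 n) p) : ℝ :=
  let u := extChartAt (𝓡 n) p p
  let H := formCoord h p
  let L : EuclideanSpace ℝ (Fin n) → EuclideanSpace ℝ (Fin n) := fun w =>
    vecCoord p ((extChartAt (𝓡 n) p).symm w) (ℓ ((extChartAt (𝓡 n) p).symm w))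
  ∑ a, ∑ b, (∑ c, (L u c * partialDeriv c (fun w => H w a b) u
      + H u c b * partialDeriv a (fun w => L w c) u
      + H u a c * partialDeriv b (fun w => L w c) u)) * vecCoord p p X a * vecCoord p p Y b

end Coordinates

/-! ### Lorentzian metrics -/

/-- A smooth metric of signature `(-, +, …, +)`: at every point there is a vector `t` with
`g(t, t) < 0` on whose orthogonal complement `g` is positive definite. -/
structure LorentzMetric (n : ℕ) (M : Type*) [TopologicalSpace M]
    [ChartedSpace (EuclideanSpace ℝ (Fin n)) M] [IsManifold (𝓡 n) ∞ M] where
  val (x : M) : TangentSpace (𝓡 n) x →L[ℝ] TangentSpace (𝓡 n) x →L[ℝ] ℝ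
  symm (x : M) (v w : TangentSpace (𝓡 n) x) : val x v w = val x w v
  lorentzian (x : M) : ∃ t : TangentSpace (𝓡 n) x, val x t t < 0 ∧
    ∀ v : TangentSpace (𝓡 n) x, val x t v = 0 → v ≠ 0 → 0 < val x v v
  contMDiff : ContMDiff (𝓡 n)
    ((𝓡 n).prod 𝓘(ℝ, EuclideanSpace ℝ (Fin n) →L[ℝ] EuclideanSpace ℝ (Fin n) →L[ℝ] ℝ)) ∞
    (fun x => TotalSpace.mk' (EuclideanSpace ℝ (Fin n) →L[ℝ] EuclideanSpace ℝ (Fin n) →L[ℝ] ℝ)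
      (E := fun x : M => TangentSpace (𝓡 n) x →L[ℝ] TangentSpace (𝓡 n) x →L[ℝ] ℝ) x (val x))

namespace LorentzMetric

section

variable {n : ℕ} {M : Type*} [TopologicalSpace M] [ChartedSpace (EuclideanSpace ℝ (Fin n)) M]
  [IsManifold (𝓡 n) ∞ M]

/-- The Ricci tensor `Ric_x(v, w)`. -/
def ricci (g : LorentzMetric n M) (x : M) (v w : TangentSpace (𝓡 n) x) : ℝ :=
  ∑ i, ∑ j, ricciCoord (formCoord g.val x) i j (extChartAt (𝓡 n) x x)
    * vecCoord x x v i * vecCoord x x w j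

/-- The scalar curvature. -/
def scalarCurvature (g : LorentzMetric n M) (x : M) : ℝ :=
  scalarCurvatureCoord (formCoord g.val x) (extChartAt (𝓡 n) x x)

/-- The Einstein tensor `Ric - ½ R g`. -/
def einstein (g : LorentzMetric n M) (x : M) (v w : TangentSpace (𝓡 n) x) : ℝ :=
  g.ricci x v w - (1 / 2) * g.scalarCurvature x * g.val x v w

end

/-! ### Hypersurfaces -/

section

variable {n d : ℕ} {M : Type*} [TopologicalSpace M] [ChartedSpace (EuclideanSpace ℝ (Fin n)) M]
  [IsManifold (𝓡 n) ∞ M] {S : Type*} [TopologicalSpace S]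
  [ChartedSpace (EuclideanSpace ℝ (Fin d)) S]

/-- The Levi-Civita derivative `∇_X V` at `p` of a field `V` of tangent vectors of `M` given along
`ι : S → M`, in the direction of a vector `X` tangent to `S`; in coordinates
`(∇_X V)ᵏ = X(Vᵏ) + Γᵏᵢⱼ Xⁱ Vʲ`. For `V` the restriction of a vector field on `M` it is the
ordinary covariant derivative in the direction of the image of `X`. -/
def covDerivAlong (g : LorentzMetric n M) (ι : S → M) (V : ∀ p : S, TangentSpace (𝓡 n) (ι p))
    (p : S) (X : TangentSpace (𝓡 d) p) : TangentSpace (𝓡 n) (ι p) :=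
  let u := extChartAt (𝓡 n) (ι p) (ι p)
  let Vc : S → EuclideanSpace ℝ (Fin n) := fun p' => vecCoord (ι p) (ι p') (V p')
  let Xc : EuclideanSpace ℝ (Fin n) := vecCoord (ι p) (ι p) (mfderiv (𝓡 d) (𝓡 n) ι p X)
  let dV : EuclideanSpace ℝ (Fin n) := mfderiv (𝓡 d) 𝓘(ℝ, EuclideanSpace ℝ (Fin n)) Vc p X
  let D : EuclideanSpace ℝ (Fin n) := WithLp.toLp 2 fun k =>
    dV k + ∑ i, ∑ j, christoffel (formCoord g.val (ι p)) k i j u * Xc i * Vc p j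
  (mfderiv (𝓡 n) 𝓘(ℝ, EuclideanSpace ℝ (Fin n)) (extChartAt (𝓡 n) (ι p)) (ι p)).inverse D

/-- The induced tensor `q = ι^* g` on `S`. -/
def induced (g : LorentzMetric n M) (ι : S → M) (p : S) :
    TangentSpace (𝓡 d) p →L[ℝ] TangentSpace (𝓡 d) p →L[ℝ] ℝ :=
  let b : EuclideanSpace ℝ (Fin n) →L[ℝ] EuclideanSpace ℝ (Fin n) →L[ℝ] ℝ := g.val (ι p)
  let A : EuclideanSpace ℝ (Fin d) →L[ℝ] EuclideanSpace ℝ (Fin n) := mfderiv (𝓡 d) (𝓡 n) ι p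
  b.bilinearComp A A

lemma induced_apply (g : LorentzMetric n M) (ι : S → M) (p : S) (X Y : TangentSpace (𝓡 d) p) :
    g.induced ι p X Y
      = g.val (ι p) (mfderiv (𝓡 d) (𝓡 n) ι p X) (mfderiv (𝓡 d) (𝓡 n) ι p Y) :=
  rfl

/-- The pullback to `S` of `∇_α ℓ_β`, for a vector field `ℓ` on `S`:
`B(X, Y) = g(∇_X ℓ, Y)` for `X`, `Y` tangent to `S`. -/
def derivTensor (g : LorentzMetric n M) (ι : S → M) (ℓ : ∀ p : S, TangentSpace (𝓡 d) p) (p : S)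
    (X Y : TangentSpace (𝓡 d) p) : ℝ :=
  g.val (ι p) (g.covDerivAlong ι (fun p' => mfderiv (𝓡 d) (𝓡 n) ι p' (ℓ p')) p X)
    (mfderiv (𝓡 d) (𝓡 n) ι p Y)

/-- The degeneracy subspace `L_p ⊆ T_p S` of the induced tensor `q`. -/
def nullDirection (g : LorentzMetric n M) (ι : S → M) (p : S) :
    Submodule ℝ (TangentSpace (𝓡 d) p) :=
  LinearMap.ker (g.induced (d := d) ι p).toLinearMap

/-- Vectors in `T_p S` whose classes form a basis of `T_p S / L_p`. -/
def screenBasis (g : LorentzMetric n M) (ι : S → M) (p : S)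
    (A : Fin (finrank ℝ (TangentSpace (𝓡 d) p ⧸ g.nullDirection (d := d) ι p))) :
    TangentSpace (𝓡 d) p :=
  haveI : FiniteDimensional ℝ (TangentSpace (𝓡 d) p) :=
    inferInstanceAs (FiniteDimensional ℝ (EuclideanSpace ℝ (Fin d)))
  Quotient.out (finBasis ℝ (TangentSpace (𝓡 d) p ⧸ g.nullDirection (d := d) ι p) A)

/-- The expansion `θ = q̄^{AB} B̄_{AB}` of a null vector field `ℓ` on a null hypersurface: the trace
of the tensor which `B` induces on `T_p S / L_p` with respect to the metric `q̄` which `q` induces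
there. The components of the two induced tensors are those of `q` and `B` on representatives. -/
def expansion (g : LorentzMetric n M) (ι : S → M) (ℓ : ∀ p : S, TangentSpace (𝓡 d) p)
    (p : S) : ℝ :=
  let e := g.screenBasis (d := d) ι p
  let Q := Matrix.of fun A B => g.induced ι p (e A) (e B)
  ∑ A, ∑ B, Q⁻¹ A B * g.derivTensor ι ℓ p (e A) (e B)

/-- `ι : S → M` is a smooth immersion and the induced tensor is degenerate at every point
(for `dim S = dim M - 1`: a null hypersurface). -/
structure IsNullSurface (g : LorentzMetric n M) (ι : S → M) : Prop where
  contMDiff : ContMDiff (𝓡 d) (𝓡 n) ∞ ι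
  injective_mfderiv (p : S) : Function.Injective (mfderiv (𝓡 d) (𝓡 n) ι p)
  degenerate (p : S) : ∃ v : TangentSpace (𝓡 d) p, v ≠ 0 ∧
    ∀ w : TangentSpace (𝓡 d) p, g.induced ι p v w = 0

variable [IsManifold (𝓡 d) ∞ S]

/-- `ℓ` is a smooth vector field on the open subset `U` of `S` whose values are null vectors
(possibly zero). Values of `ℓ` outside of `U` are irrelevant. -/
structure IsNullField (g : LorentzMetric n M) (ι : S → M) (U : Set S)
    (ℓ : ∀ p : S, TangentSpace (𝓡 d) p) : Prop where
  isOpen : IsOpen U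
  contMDiffOn : ContMDiffOn (𝓡 d) (𝓡 d).tangent ∞
    (fun p => (⟨p, ℓ p⟩ : TangentBundle (𝓡 d) S)) U
  null (p : S) (hp : p ∈ U) : g.induced ι p (ℓ p) (ℓ p) = 0

/-- At every point the expansion of some local null vector field which is non-zero there
vanishes. -/
def IsNonExpanding (g : LorentzMetric n M) (ι : S → M) : Prop :=
  ∀ p : S, ∃ (U : Set S) (ℓ : ∀ p : S, TangentSpace (𝓡 d) p),
    g.IsNullField ι U ℓ ∧ p ∈ U ∧ ℓ p ≠ 0 ∧ g.expansion ι ℓ p = 0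

end

end LorentzMetric

end

/-!
In charts, write `ι` as a map `F` and a non-vanishing null field as `ℓ`. Since `g(∇_X ℓ, ℓ) = 0`
and `ℓ^⊥ = T Δ`, there is a Weingarten map `W` with `∇_X ℓ = F_* (W X)` and `W ℓ = κ ℓ`; it is
symmetric with respect to `q` because the connection is torsion free. The trace of the operator
`Z ↦ R(Z, ℓ) ℓ`, computed from `W`, is the Raychaudhuri equation
`Ric(ℓ, ℓ) = -ℓ(θ) + κ θ - (tr W² - κ²)` with `θ = tr W - κ`. Let `W̄` be the map which `W` induces
on `T Δ / L`. It is symmetric for the positive definite metric `q̄`, so that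
`tr W² - κ² = tr W̄² ≥ 0`, with equality only for `W̄ = 0`. The expansion of every null field
vanishes because `∇_a ℓ_b` at `p` scales with `ℓ(p)`, hence `Ric(ℓ, ℓ) ≥ 0` forces both
`Ric(ℓ, ℓ) = 0` and `∇_a ℓ_b = 0`, and `ℒ_ℓ q = 2 ∇_a ℓ_b`. The Einstein equations enter only
through `Ric(ℓ, ℓ) = T(ℓ, ℓ)` for null `ℓ`.
-/

local notation "𝔼" n:max => EuclideanSpace ℝ (Fin n)

section LinearAlgebra

open LinearMap (BilinForm)

variable {K V V' : Type*} [AddCommGroup V] [AddCommGroup V']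

section Trace

variable [Field K] [Module K V] [Module K V']

lemma sum_inv_mul_apply_eq_trace {B : BilinForm K V} (hs : B.IsSymm) (hB : B.Nondegenerate)
    {ι : Type*} [Fintype ι] [DecidableEq ι] (b : Basis ι K V) (f : V →ₗ[K] V) :
    ∑ i, ∑ j, (LinearMap.BilinForm.toMatrix b B)⁻¹ i j * B (f (b i)) (b j)
      = LinearMap.trace K V f := by
  set Q := LinearMap.BilinForm.toMatrix b B with hQ
  have h_unit : IsUnit Q.det := ((LinearMap.BilinForm.nondegenerate_iff_det_ne_zero b).1 hB).isUnit
  have hQs : Q.transpose = Q := by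
    ext i j
    simp [hQ, LinearMap.BilinForm.toMatrix_apply, hs.eq (b j)]
  calc ∑ i, ∑ j, Q⁻¹ i j * B (f (b i)) (b j)
      = (Q⁻¹ * (LinearMap.BilinForm.toMatrix b (B.compLeft f)).transpose).trace := by
        simp [← Matrix.sum_hadamard_eq, Matrix.hadamard_apply, LinearMap.BilinForm.toMatrix_apply]
    _ = (LinearMap.toMatrix b b f).trace := by
        rw [LinearMap.BilinForm.toMatrix_compLeft, Matrix.transpose_mul,
          Matrix.transpose_transpose, hQs, Matrix.nonsing_inv_mul_cancel_left _ _ h_unit]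
    _ = LinearMap.trace K V f := (LinearMap.trace_eq_matrix_trace K b f).symm

variable [FiniteDimensional K V] [FiniteDimensional K V']

lemma trace_eq_trace_restrict_add_trace_mapQ (f : V →ₗ[K] V) {N : Submodule K V}
    (hN : N ≤ N.comap f) :
    LinearMap.trace K V f
      = LinearMap.trace K N (f.restrict hN) + LinearMap.trace K (V ⧸ N) (N.mapQ N f hN) := by
  obtain ⟨p, hp⟩ := N.subtype.exists_leftInverse_of_injective N.ker_subtype
  have hpN (x : N) : p x = x := LinearMap.congr_fun hp x
  let s : V ⧸ N →ₗ[K] V := N.liftQ (LinearMap.id - N.subtype ∘ₗ p) fun x hx => by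
    simp [hpN ⟨x, hx⟩]
  have h_restrict : f.restrict hN = p ∘ₗ f ∘ₗ N.subtype :=
    LinearMap.ext fun x => (hpN (f.restrict hN x)).symm
  have h_mapQ : N.mapQ N f hN = N.mkQ ∘ₗ f ∘ₗ s := by
    refine Submodule.linearMap_qext _ (LinearMap.ext fun x => ?_)
    have hfp : f (p x) ∈ N := hN (p x).2
    simp [s, (Submodule.Quotient.mk_eq_zero N).2 hfp]
  rw [h_restrict, h_mapQ, LinearMap.trace_comp_comm' (f ∘ₗ N.subtype) p,
    LinearMap.trace_comp_comm' (f ∘ₗ s) N.mkQ, ← map_add]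
  congr 1
  ext x
  simp [s]

lemma trace_eq_add_trace_mapQ_of_finrank_eq_one {f : V →ₗ[K] V} {N : Submodule K V}
    (h1 : finrank K N = 1) {c : K} (hf : ∀ x ∈ N, f x = c • x) (hN : N ≤ N.comap f) :
    LinearMap.trace K V f = c + LinearMap.trace K (V ⧸ N) (N.mapQ N f hN) := by
  have h_restrict : f.restrict hN = c • LinearMap.id :=
    LinearMap.ext fun x => Subtype.ext (hf x x.2)
  rw [trace_eq_trace_restrict_add_trace_mapQ f hN, h_restrict, map_smul, LinearMap.trace_id, h1]
  simp

lemma trace_eq_of_injective_of_apply_eq {A : V →ₗ[K] V'} (hA : Function.Injective A)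
    {f' : V' →ₗ[K] V'} {f : V →ₗ[K] V} (hf' : ∀ z, f' z ∈ LinearMap.range A)
    (hf : ∀ x, f' (A x) = A (f x)) :
    LinearMap.trace K V' f' = LinearMap.trace K V f := by
  obtain ⟨P, hP⟩ := A.exists_leftInverse_of_injective (LinearMap.ker_eq_bot.2 hA)
  have hPA (x : V) : P (A x) = x := LinearMap.congr_fun hP x
  have h_factor : f' = A ∘ₗ P ∘ₗ f' := by
    ext z
    obtain ⟨x, hx⟩ := hf' z
    simp [← hx, hPA]
  have h_conj : f = (P ∘ₗ f') ∘ₗ A := by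
    ext x
    simp [hf, hPA]
  rw [h_factor, LinearMap.trace_comp_comm', ← h_conj]

end Trace

section ReducedForm

variable [Field K] [Module K V] {B : BilinForm K V}

/-- The form induced on `V ⧸ ker B` by a symmetric bilinear form `B`: on a null hypersurface it is
the positive definite metric `q̄` of the spaces `T_p S / L_p`. -/
def reducedForm (B : BilinForm K V) (hs : B.IsSymm) :
    BilinForm K (V ⧸ LinearMap.ker B) :=
  LinearMap.IsRefl.liftQ₂ B (LinearMap.ker B) hs.isRefl le_rfl

lemma reducedForm_mk (hs : B.IsSymm) (x y : V) :
    reducedForm B hs (Submodule.Quotient.mk x) (Submodule.Quotient.mk y) = B x y :=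
  rfl

lemma isSymm_reducedForm (hs : B.IsSymm) : (reducedForm B hs).IsSymm where
  eq x y := by
    obtain ⟨x, rfl⟩ := Submodule.Quotient.mk_surjective _ x
    obtain ⟨y, rfl⟩ := Submodule.Quotient.mk_surjective _ y
    exact hs.eq x y

lemma nondegenerate_reducedForm [FiniteDimensional K V] (hs : B.IsSymm) :
    (reducedForm B hs).Nondegenerate := by
  refine LinearMap.BilinForm.Nondegenerate.ofSeparatingLeft fun x hx => ?_
  obtain ⟨x, rfl⟩ := Submodule.Quotient.mk_surjective _ x
  exact (Submodule.Quotient.mk_eq_zero _).2 (LinearMap.ext fun y => hx (Submodule.Quotient.mk y))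

lemma sum_inv_gram_mul_eq_trace_mapQ [FiniteDimensional K V] (hs : B.IsSymm)
    {N : Submodule K V} (hN : LinearMap.ker B = N) {f : V →ₗ[K] V} (hf : N ≤ N.comap f)
    {ι : Type*} [Fintype ι] [DecidableEq ι] (b : Basis ι K (V ⧸ N))
    {e : ι → V} (he : ∀ i, Submodule.Quotient.mk (e i) = b i) :
    ∑ i, ∑ j, (Matrix.of fun i j => B (e i) (e j))⁻¹ i j * B (f (e i)) (e j)
      = LinearMap.trace K _ (N.mapQ N f hf) := by
  subst hN
  rw [← sum_inv_mul_apply_eq_trace (isSymm_reducedForm hs) (nondegenerate_reducedForm hs) b]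
  have h_gram : LinearMap.BilinForm.toMatrix b (reducedForm B hs)
      = Matrix.of fun i j => B (e i) (e j) := by
    ext i j
    rw [LinearMap.BilinForm.toMatrix_apply, ← he, ← he, reducedForm_mk, Matrix.of_apply]
  simp only [h_gram, ← he, Submodule.mapQ_apply, reducedForm_mk]

end ReducedForm

section Ordered

variable [Field K] [LinearOrder K] [Module K V] {B : BilinForm K V}

lemma isPosSemidef_reducedForm (hB : B.IsPosSemidef) :
    (reducedForm B hB.isSymm).IsPosSemidef where
  isSymm := isSymm_reducedForm hB.isSymm
  isNonneg := ⟨fun x => by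
    obtain ⟨x, rfl⟩ := Submodule.Quotient.mk_surjective _ x
    exact hB.isNonneg.nonneg x⟩

variable [IsStrictOrderedRing K]

lemma apply_self_pos_of_ne_zero (hB : B.IsPosSemidef) (hB' : B.Nondegenerate) {x : V}
    (hx : x ≠ 0) : 0 < B x x :=
  (B.nondegenerate_iff' hB.isNonneg.nonneg (LinearMap.BilinForm.isSymm_iff.1 hB.isSymm)).1 hB' x hx

variable [FiniteDimensional K V] {f : V →ₗ[K] V}

lemma exists_basis_trace_comp_self_eq_sum_div (hs : B.IsSymm) (hB : B.Nondegenerate)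
    (hf : ∀ x y, B (f x) y = B x (f y)) :
    ∃ b : Basis (Fin (finrank K V)) K V,
      LinearMap.trace K V (f ∘ₗ f) = ∑ i, B (f (b i)) (f (b i)) / B (b i) (b i) := by
  have : Invertible (2 : K) := invertibleOfNonzero two_ne_zero
  obtain ⟨b, hb⟩ := LinearMap.BilinForm.exists_orthogonal_basis
    (LinearMap.BilinForm.isSymm_iff.1 hs)
  refine ⟨b, ?_⟩
  have h_diag : LinearMap.BilinForm.toMatrix b B = Matrix.diagonal fun i => B (b i) (b i) := by
    ext i j
    rcases eq_or_ne i j with rfl | hij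
    · simp [LinearMap.BilinForm.toMatrix_apply]
    · simp only [LinearMap.BilinForm.toMatrix_apply, Matrix.diagonal_apply_ne _ hij]
      exact hb hij
  have h_inv : (LinearMap.BilinForm.toMatrix b B)⁻¹
      = Matrix.diagonal fun i => (B (b i) (b i))⁻¹ := by
    refine Matrix.inv_eq_left_inv ?_
    rw [h_diag, Matrix.diagonal_mul_diagonal, ← Matrix.diagonal_one]
    congr 1
    ext i
    exact inv_mul_cancel₀ (hb.not_isOrtho_basis_self_of_separatingLeft hB.1 i)
  rw [← sum_inv_mul_apply_eq_trace hs hB b, h_inv]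
  simp [Matrix.diagonal_apply, hf, div_eq_inv_mul]

lemma trace_comp_self_nonneg (hB : B.IsPosSemidef) (hB' : B.Nondegenerate)
    (hf : ∀ x y, B (f x) y = B x (f y)) : 0 ≤ LinearMap.trace K V (f ∘ₗ f) := by
  obtain ⟨b, hb⟩ := exists_basis_trace_comp_self_eq_sum_div hB.isSymm hB' hf
  exact hb ▸ Finset.sum_nonneg fun i _ =>
    div_nonneg (hB.isNonneg.nonneg _) (hB.isNonneg.nonneg _)

lemma eq_zero_of_trace_comp_self_eq_zero (hB : B.IsPosSemidef) (hB' : B.Nondegenerate)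
    (hf : ∀ x y, B (f x) y = B x (f y)) (h0 : LinearMap.trace K V (f ∘ₗ f) = 0) : f = 0 := by
  obtain ⟨b, hb⟩ := exists_basis_trace_comp_self_eq_sum_div hB.isSymm hB' hf
  have h_nonneg (i) : 0 ≤ B (f (b i)) (f (b i)) / B (b i) (b i) :=
    div_nonneg (hB.isNonneg.nonneg _) (hB.isNonneg.nonneg _)
  refine b.ext fun i => ?_
  by_contra hfi
  have h_pos : 0 < B (f (b i)) (f (b i)) / B (b i) (b i) :=
    div_pos (apply_self_pos_of_ne_zero hB hB' hfi) (apply_self_pos_of_ne_zero hB hB' (b.ne_zero i))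
  rw [hb, Finset.sum_eq_zero_iff_of_nonneg fun i _ => h_nonneg i] at h0
  exact h_pos.ne' (h0 i (Finset.mem_univ i))

lemma sq_le_trace_comp_self (hB : B.IsPosSemidef) (h1 : finrank K (LinearMap.ker B) = 1)
    (hf : ∀ x y, B (f x) y = B x (f y)) {c : K} (hc : ∀ x ∈ LinearMap.ker B, f x = c • x) :
    c ^ 2 ≤ LinearMap.trace K V (f ∘ₗ f) ∧
      (LinearMap.trace K V (f ∘ₗ f) = c ^ 2 → ∀ x y, B (f x) y = 0) := by
  have hker : LinearMap.ker B ≤ (LinearMap.ker B).comap f := fun x hx => by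
    rw [Submodule.mem_comap, hc x hx]
    exact Submodule.smul_mem _ c hx
  set f' := (LinearMap.ker B).mapQ _ f hker with hf'
  have h_trace : LinearMap.trace K V (f ∘ₗ f) = c ^ 2 + LinearMap.trace K _ (f' ∘ₗ f') := by
    rw [hf', ← Submodule.mapQ_comp]
    refine trace_eq_add_trace_mapQ_of_finrank_eq_one h1 (fun x hx => ?_) _
    rw [LinearMap.comp_apply, hc x hx, map_smul, hc x hx, smul_smul, sq]
  have h_symm (x y) : reducedForm B hB.isSymm (f' x) y = reducedForm B hB.isSymm x (f' y) := by
    obtain ⟨x, rfl⟩ := Submodule.Quotient.mk_surjective _ x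
    obtain ⟨y, rfl⟩ := Submodule.Quotient.mk_surjective _ y
    exact hf x y
  have hB₀ := isPosSemidef_reducedForm hB
  have hB₁ := nondegenerate_reducedForm hB.isSymm
  refine ⟨by linarith [trace_comp_self_nonneg hB₀ hB₁ h_symm], fun h x y => ?_⟩
  have h_zero : f' = 0 := eq_zero_of_trace_comp_self_eq_zero hB₀ hB₁ h_symm (by linarith)
  have h_mk : (Submodule.Quotient.mk (f x) : V ⧸ LinearMap.ker B) = 0 :=
    LinearMap.congr_fun h_zero (Submodule.Quotient.mk x)
  exact LinearMap.congr_fun ((Submodule.Quotient.mk_eq_zero _).1 h_mk) y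

end Ordered

section Lorentzian

variable [Field K] [LinearOrder K] [Module K V] [Module K V']
  {B : BilinForm K V}

/-- A symmetric bilinear form of signature `(-, +, …, +)`, in the encoding of `LorentzMetric`: it
is positive definite on the orthogonal complement of some vector `t` with `B t t < 0`. -/
structure IsLorentzian (B : BilinForm K V) : Prop where
  isSymm : B.IsSymm
  exists_timelike : ∃ t, B t t < 0 ∧ ∀ v, B t v = 0 → v ≠ 0 → 0 < B v v

namespace IsLorentzian

lemma separatingLeft (hB : IsLorentzian B) : B.SeparatingLeft := by
  obtain ⟨t, -, ht⟩ := hB.exists_timelike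
  intro v hv
  by_contra h
  exact (ht v (by rw [← hB.isSymm.eq]; exact hv t) h).ne' (hv v)

lemma exists_eq_smul_or_pos (hB : IsLorentzian B) {k : V} (hk : k ≠ 0) (hkk : B k k = 0) {v : V}
    (hv : B k v = 0) :
    (∃ c : K, v = c • k) ∨ 0 < B v v := by
  obtain ⟨t, -, ht⟩ := hB.exists_timelike
  have htk : B t k ≠ 0 := fun h => (ht k h hk).ne' hkk
  have hvk : B v k = 0 := by rw [← hB.isSymm.eq]; exact hv
  set c := B t v / B t k with hc
  have h_self : B (v - c • k) (v - c • k) = B v v := by simp [hkk, hv, hvk]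
  rcases eq_or_ne (v - c • k) 0 with h | h
  · exact .inl ⟨c, sub_eq_zero.1 h⟩
  · exact .inr (h_self ▸ ht _ (by simp [hc, htk]) h)

variable {A : V' →ₗ[K] V} {v : V'}

lemma isPosSemidef_comp (hB : IsLorentzian B) (hA : Function.Injective A)
    (hv : v ≠ 0) (hq : ∀ y, B (A v) (A y) = 0) :
    (B.comp A A).IsPosSemidef where
  isSymm := ⟨fun x y => hB.isSymm.eq (A x) (A y)⟩
  isNonneg := ⟨fun x => by
    rcases hB.exists_eq_smul_or_pos ((map_ne_zero_iff A hA).2 hv) (hq v) (hq x) with ⟨c, hc⟩ | h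
    · simp [hc, hq v]
    · exact h.le⟩

lemma ker_comp_eq_span (hB : IsLorentzian B) (hA : Function.Injective A) (hv : v ≠ 0)
    (hq : ∀ y, B (A v) (A y) = 0) : LinearMap.ker (B.comp A A) = K ∙ v := by
  refine le_antisymm (fun x hx => ?_) ((Submodule.span_singleton_le_iff_mem _ _).2
    (LinearMap.ext hq))
  rcases hB.exists_eq_smul_or_pos ((map_ne_zero_iff A hA).2 hv) (hq v) (hq x) with ⟨c, hc⟩ | h
  · rw [← map_smul] at hc
    exact Submodule.mem_span_singleton.2 ⟨c, (hA hc).symm⟩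
  · exact absurd (LinearMap.congr_fun hx x) h.ne'

lemma mem_range_of_apply_eq_zero [FiniteDimensional K V] (hB : IsLorentzian B)
    (hdim : finrank K V = finrank K V' + 1) (hA : Function.Injective A) (hv : v ≠ 0)
    (hq : ∀ y, B (A v) (A y) = 0) {z : V} (hz : B (A v) z = 0) :
    z ∈ LinearMap.range A := by
  have h_ne : B (A v) ≠ 0 := fun h =>
    (map_ne_zero_iff A hA).2 hv (hB.separatingLeft _ (LinearMap.congr_fun h))
  have h_le : LinearMap.range A ≤ LinearMap.ker (B (A v)) := by
    rintro _ ⟨y, rfl⟩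
    exact hq y
  have h_finrank : finrank K (LinearMap.range A) = finrank K (LinearMap.ker (B (A v))) := by
    have := Module.Dual.finrank_ker_add_one_of_ne_zero h_ne
    rw [LinearMap.finrank_range_of_inj hA]
    omega
  rw [Submodule.eq_of_le_of_finrank_eq h_le h_finrank]
  exact hz

end IsLorentzian

end Lorentzian

end LinearAlgebra

section CovariantCalculus

set_option maxSynthPendingDepth 3

open Filter Topology

variable {D E : Type*} [NormedAddCommGroup D] [NormedSpace ℝ D]
  [NormedAddCommGroup E] [NormedSpace ℝ E]

/-- The covariant derivative `X ↦ ∇_X V = X(V) + Γ(F_* X, V)` of a field `V` along the map `F`, for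
the connection on a vector space with Christoffel form `Γ`. -/
noncomputable def covAlong (Γ : E → E →L[ℝ] E →L[ℝ] E) (F V : D → E) (u : D) : D →L[ℝ] E :=
  fderiv ℝ V u + (Γ (F u)).flip (V u) ∘L fderiv ℝ F u

/-- The curvature `R(a, b) c = [∇_a, ∇_b] c` at `x` of the connection with Christoffel form `Γ`. -/
noncomputable def curvatureForm (Γ : E → E →L[ℝ] E →L[ℝ] E) (x : E) : E →L[ℝ] E →L[ℝ] E →L[ℝ] E :=
  fderiv ℝ Γ x - (fderiv ℝ Γ x).flip
    + ((ContinuousLinearMap.compL ℝ E E E).bilinearComp (Γ x) (Γ x)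
      - ((ContinuousLinearMap.compL ℝ E E E).bilinearComp (Γ x) (Γ x)).flip)

/-- The Jacobi operator `z ↦ R(z, v) v`, whose trace is `Ric(v, v)`. -/
noncomputable def jacobiOperator (Γ : E → E →L[ℝ] E →L[ℝ] E) (x v : E) : E →L[ℝ] E :=
  ((curvatureForm Γ x).flip v).flip v

/-- `g` is parallel at `x` for the connection with Christoffel form `Γ`. -/
def IsParallelAt (Γ : E → E →L[ℝ] E →L[ℝ] E) (g : E → E →L[ℝ] E →L[ℝ] ℝ) (x : E) : Prop :=
  ∀ z v w, fderiv ℝ g x z v w = g x (Γ x z v) w + g x v (Γ x z w)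

lemma covAlong_apply (Γ : E → E →L[ℝ] E →L[ℝ] E) (F V : D → E) (u X : D) :
    covAlong Γ F V u X = fderiv ℝ V u X + Γ (F u) (fderiv ℝ F u X) (V u) :=
  rfl

lemma curvatureForm_apply (Γ : E → E →L[ℝ] E →L[ℝ] E) (x a b c : E) :
    curvatureForm Γ x a b c
      = fderiv ℝ Γ x a b c - fderiv ℝ Γ x b a c + (Γ x a (Γ x b c) - Γ x b (Γ x a c)) :=
  rfl

lemma jacobiOperator_apply (Γ : E → E →L[ℝ] E →L[ℝ] E) (x v z : E) :
    jacobiOperator Γ x v z = curvatureForm Γ x z v v :=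
  rfl

lemma fderiv_clm_apply_const {E' : Type*} [NormedAddCommGroup E'] [NormedSpace ℝ E']
    {f : D → E' →L[ℝ] E} {u : D} (hf : DifferentiableAt ℝ f u) (X : D) (Y : E') :
    fderiv ℝ (fun w => f w Y) u X = fderiv ℝ f u X Y := by
  rw [(hf.hasFDerivAt.clm_apply (hasFDerivAt_const Y u)).fderiv]
  simp

variable {Γ : E → E →L[ℝ] E →L[ℝ] E} {F V V' : D → E} {u : D}

lemma covAlong_congr_of_eventuallyEq (h : V =ᶠ[𝓝 u] V') :
    covAlong Γ F V u = covAlong Γ F V' u := by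
  rw [covAlong, covAlong, h.fderiv_eq, h.self_of_nhds]

lemma fderiv_metric_apply {g : E → E →L[ℝ] E →L[ℝ] ℝ} (hg : DifferentiableAt ℝ g (F u))
    (hF : DifferentiableAt ℝ F u) (hV : DifferentiableAt ℝ V u) (hV' : DifferentiableAt ℝ V' u)
    (hΓ : IsParallelAt Γ g (F u)) (X : D) :
    fderiv ℝ (fun u => g (F u) (V u) (V' u)) u X
      = g (F u) (covAlong Γ F V u X) (V' u) + g (F u) (V u) (covAlong Γ F V' u X) := by
  have hgF : HasFDerivAt (fun u => g (F u)) (fderiv ℝ g (F u) ∘L fderiv ℝ F u) u :=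
    hg.hasFDerivAt.comp u hF.hasFDerivAt
  rw [((hgF.clm_apply hV.hasFDerivAt).clm_apply hV'.hasFDerivAt).fderiv]
  simp only [covAlong_apply, _root_.add_apply, ContinuousLinearMap.comp_apply,
    ContinuousLinearMap.flip_apply, map_add, hΓ _ _ _]
  ring

lemma fderiv_covAlong_apply (hF : ContDiffAt ℝ 2 F u) (hV : ContDiffAt ℝ 2 V u)
    (hΓ : DifferentiableAt ℝ Γ (F u)) (X Y : D) :
    fderiv ℝ (fun w => covAlong Γ F V w Y) u X
      = fderiv ℝ (fderiv ℝ V) u X Y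
        + (fderiv ℝ Γ (F u) (fderiv ℝ F u X) (fderiv ℝ F u Y) (V u)
          + Γ (F u) (fderiv ℝ (fderiv ℝ F) u X Y) (V u)
          + Γ (F u) (fderiv ℝ F u Y) (fderiv ℝ V u X)) := by
  have hF' := (hF.fderiv_right (m := 1) (by norm_num)).differentiableAt (by norm_num)
  have hV' := (hV.fderiv_right (m := 1) (by norm_num)).differentiableAt (by norm_num)
  have hY := hasFDerivAt_const (𝕜 := ℝ) Y u
  have hΓF : HasFDerivAt (fun w => Γ (F w)) (fderiv ℝ Γ (F u) ∘L fderiv ℝ F u) u :=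
    hΓ.hasFDerivAt.comp u (hF.differentiableAt (by norm_num)).hasFDerivAt
  have h := (hV'.hasFDerivAt.clm_apply hY).add
    ((hΓF.clm_apply (hF'.hasFDerivAt.clm_apply hY)).clm_apply
      (hV.differentiableAt (by norm_num)).hasFDerivAt)
  rw [show fderiv ℝ (fun w => covAlong Γ F V w Y) u = _ from h.fderiv]
  simp only [_root_.add_apply, ContinuousLinearMap.comp_apply, ContinuousLinearMap.flip_apply,
    _root_.zero_apply, map_zero, zero_add]
  abel

lemma covAlong_covAlong_sub (hF : ContDiffAt ℝ 2 F u) (hV : ContDiffAt ℝ 2 V u)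
    (hΓ : DifferentiableAt ℝ Γ (F u)) (X Y : D) :
    covAlong Γ F (fun w => covAlong Γ F V w Y) u X - covAlong Γ F (fun w => covAlong Γ F V w X) u Y
      = curvatureForm Γ (F u) (fderiv ℝ F u X) (fderiv ℝ F u Y) (V u) := by
  rw [covAlong_apply Γ F (fun w => covAlong Γ F V w Y),
    covAlong_apply Γ F (fun w => covAlong Γ F V w X), fderiv_covAlong_apply hF hV hΓ,
    fderiv_covAlong_apply hF hV hΓ, (hF.isSymmSndFDerivAt (by simp)).eq X Y,
    (hV.isSymmSndFDerivAt (by simp)).eq X Y, covAlong_apply, covAlong_apply, curvatureForm_apply]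
  simp only [map_add]
  abel

lemma covAlong_fderiv_comm (hF : ContDiffAt ℝ 2 F u) (hΓ : ∀ v w, Γ (F u) v w = Γ (F u) w v)
    (X Y : D) :
    covAlong Γ F (fun w => fderiv ℝ F w Y) u X = covAlong Γ F (fun w => fderiv ℝ F w X) u Y := by
  have hF' : DifferentiableAt ℝ (fderiv ℝ F) u :=
    (hF.fderiv_right (m := 1) (by norm_num)).differentiableAt (by norm_num)
  rw [covAlong_apply, covAlong_apply, fderiv_clm_apply_const hF', fderiv_clm_apply_const hF',
    (hF.isSymmSndFDerivAt (by simp)).eq X Y, hΓ (fderiv ℝ F u X)]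

lemma covAlong_fderiv_apply {L : D → D} (hF : ContDiffAt ℝ 2 F u) (hL : DifferentiableAt ℝ L u)
    (X : D) :
    covAlong Γ F (fun w => fderiv ℝ F w (L w)) u X
      = covAlong Γ F (fun w => fderiv ℝ F w (L u)) u X + fderiv ℝ F u (fderiv ℝ L u X) := by
  have hF' : DifferentiableAt ℝ (fderiv ℝ F) u :=
    (hF.fderiv_right (m := 1) (by norm_num)).differentiableAt (by norm_num)
  rw [covAlong_apply, covAlong_apply, fderiv_clm_apply_const hF',
    (hF'.hasFDerivAt.clm_apply hL.hasFDerivAt).fderiv]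
  simp only [_root_.add_apply, ContinuousLinearMap.comp_apply, ContinuousLinearMap.flip_apply]
  abel

lemma curvatureForm_fderiv_of_covAlong_eq {W : D → D →L[ℝ] D} (hF : ContDiffAt ℝ 2 F u)
    (hV : ContDiffAt ℝ 2 V u) (hW : DifferentiableAt ℝ W u) (hΓ : DifferentiableAt ℝ Γ (F u))
    (h : ∀ᶠ w in 𝓝 u, covAlong Γ F V w = fderiv ℝ F w ∘L W w) (X Y : D) :
    curvatureForm Γ (F u) (fderiv ℝ F u X) (fderiv ℝ F u Y) (V u)
      = covAlong Γ F (fun w => fderiv ℝ F w (W u Y)) u X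
        - covAlong Γ F (fun w => fderiv ℝ F w (W u X)) u Y
        + fderiv ℝ F u (fderiv ℝ W u X Y - fderiv ℝ W u Y X) := by
  have h_apply (X Y : D) : covAlong Γ F (fun w => covAlong Γ F V w Y) u X
      = covAlong Γ F (fun w => fderiv ℝ F w (W u Y)) u X + fderiv ℝ F u (fderiv ℝ W u X Y) := by
    have hVW : (fun w => covAlong Γ F V w Y) =ᶠ[𝓝 u] fun w => fderiv ℝ F w (W w Y) :=
      h.mono fun w hw => DFunLike.congr_fun hw Y
    rw [covAlong_congr_of_eventuallyEq hVW,
      covAlong_fderiv_apply hF (hW.clm_apply (differentiableAt_const Y)),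
      fderiv_clm_apply_const hW]
  rw [← covAlong_covAlong_sub hF hV hΓ, h_apply, h_apply, map_sub]
  abel

lemma fderiv_fderiv_metric_apply_self {g : E → E →L[ℝ] E →L[ℝ] ℝ} {x : E} (hg : ContDiffAt ℝ 2 g x)
    (hgs : ∀ᶠ y in 𝓝 x, ∀ v w, g y v w = g y w v) (hΓ : DifferentiableAt ℝ Γ x)
    (hp : ∀ᶠ y in 𝓝 x, IsParallelAt Γ g y) (a b c : E) :
    fderiv ℝ (fderiv ℝ g) x a b c c
      = 2 * (g x (fderiv ℝ Γ x a b c) c + g x (Γ x a (Γ x b c)) c + g x (Γ x b c) (Γ x a c)) := by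
  have hc := hasFDerivAt_const (𝕜 := ℝ) c x
  have hb := hasFDerivAt_const (𝕜 := ℝ) b x
  have hg' : DifferentiableAt ℝ (fderiv ℝ g) x :=
    (hg.fderiv_right (m := 1) (by norm_num)).differentiableAt (by norm_num)
  have h_first : (fun y => fderiv ℝ g y b c c) =ᶠ[𝓝 x] fun y => 2 * g y (Γ y b c) c := by
    filter_upwards [hp, hgs] with y hpy hgy
    rw [hpy, hgy c]
    ring
  have h_left := ((hg'.hasFDerivAt.clm_apply hb).clm_apply hc).clm_apply hc
  have h_right := (((hg.differentiableAt (by norm_num)).hasFDerivAt.clm_apply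
    ((hΓ.hasFDerivAt.clm_apply hb).clm_apply hc)).clm_apply hc).const_mul (2 : ℝ)
  have h_second := DFunLike.congr_fun (h_left.unique (h_right.congr_of_eventuallyEq h_first)) a
  simp only [_root_.add_apply, ContinuousLinearMap.comp_apply, ContinuousLinearMap.flip_apply,
    _root_.zero_apply, map_zero, zero_add, _root_.smul_apply, smul_eq_mul] at h_second
  rw [h_second, hp.self_of_nhds]
  ring

lemma metric_curvatureForm_self {g : E → E →L[ℝ] E →L[ℝ] ℝ} {x : E} (hg : ContDiffAt ℝ 2 g x)
    (hgs : ∀ᶠ y in 𝓝 x, ∀ v w, g y v w = g y w v) (hΓ : DifferentiableAt ℝ Γ x)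
    (hp : ∀ᶠ y in 𝓝 x, IsParallelAt Γ g y) (a b c : E) :
    g x (curvatureForm Γ x a b c) c = 0 := by
  have h := fderiv_fderiv_metric_apply_self hg hgs hΓ hp a b c
  rw [(hg.isSymmSndFDerivAt (by simp)).eq a b, fderiv_fderiv_metric_apply_self hg hgs hΓ hp b a c,
    hgs.self_of_nhds (Γ x a c)] at h
  simp only [curvatureForm_apply, map_add, map_sub, _root_.add_apply, _root_.sub_apply]
  linarith

/-- The right hand side of the Riccati equation `R(·, ℓ) ℓ = dκ ⊗ ℓ + κ W - W² - ℒ_ℓ W`. -/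
noncomputable def riccatiMap (L : D → D) (W : D → D →L[ℝ] D) (κ : D → ℝ) (u : D) : D →L[ℝ] D :=
  (fderiv ℝ κ u).smulRight (L u) + κ u • W u - W u ∘L W u
    - (fderiv ℝ W u (L u) - fderiv ℝ L u ∘L W u + W u ∘L fderiv ℝ L u)

/-- The field `F_* L` along `F` has Weingarten map `W` near `u`, that is `∇_X (F_* L) = F_* (W X)`,
and surface gravity `κ`, that is `W L = κ L`; all the data are differentiable as often as the
Raychaudhuri equation requires. -/
structure IsWeingartenAt (Γ : E → E →L[ℝ] E →L[ℝ] E) (F : D → E) (L : D → D) (W : D → D →L[ℝ] D)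
    (κ : D → ℝ) (u : D) : Prop where
  contDiffAt_map : ContDiffAt ℝ 3 F u
  contDiffAt_field : ContDiffAt ℝ 2 L u
  differentiableAt_weingarten : DifferentiableAt ℝ W u
  differentiableAt_gravity : DifferentiableAt ℝ κ u
  covAlong_eq : ∀ᶠ w in 𝓝 u, covAlong Γ F (fun w => fderiv ℝ F w (L w)) w = fderiv ℝ F w ∘L W w
  apply_field : ∀ᶠ w in 𝓝 u, W w (L w) = κ w • L w

namespace IsWeingartenAt

variable {L : D → D} {W : D → D →L[ℝ] D} {κ : D → ℝ}

lemma fderiv_apply_field (hW : IsWeingartenAt Γ F L W κ u) (X : D) :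
    fderiv ℝ W u X (L u) + W u (fderiv ℝ L u X)
      = fderiv ℝ κ u X • L u + κ u • fderiv ℝ L u X := by
  have hL := (hW.contDiffAt_field.differentiableAt (by norm_num)).hasFDerivAt
  have h_left := hW.differentiableAt_weingarten.hasFDerivAt.clm_apply hL
  have h_right := hW.differentiableAt_gravity.hasFDerivAt.smul hL
  have h := DFunLike.congr_fun (h_left.unique (h_right.congr_of_eventuallyEq hW.apply_field)) X
  simp only [_root_.add_apply, ContinuousLinearMap.comp_apply, ContinuousLinearMap.flip_apply,
    _root_.smul_apply, ContinuousLinearMap.smulRight_apply] at h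
  rw [add_comm, h, add_comm]

lemma jacobiOperator_fderiv_apply (hW : IsWeingartenAt Γ F L W κ u)
    (hΓ : DifferentiableAt ℝ Γ (F u)) (hΓs : ∀ v w, Γ (F u) v w = Γ (F u) w v) (X : D) :
    jacobiOperator Γ (F u) (fderiv ℝ F u (L u)) (fderiv ℝ F u X)
      = fderiv ℝ F u (riccatiMap L W κ u X) := by
  have hF : ContDiffAt ℝ 2 F u := hW.contDiffAt_map.of_le (by norm_num)
  have hV : ContDiffAt ℝ 2 (fun w => fderiv ℝ F w (L w)) u :=
    (hW.contDiffAt_map.fderiv_right (m := 2) (by norm_num)).clm_apply hW.contDiffAt_field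
  have h_cov (X : D) : covAlong Γ F (fun w => fderiv ℝ F w (L u)) u X
      = fderiv ℝ F u (W u X) - fderiv ℝ F u (fderiv ℝ L u X) := by
    rw [eq_sub_iff_add_eq,
      ← covAlong_fderiv_apply hF (hW.contDiffAt_field.differentiableAt (by norm_num)),
      hW.covAlong_eq.self_of_nhds, ContinuousLinearMap.comp_apply]
  have h_cov_smul : covAlong Γ F (fun w => fderiv ℝ F w (κ u • L u)) u X
      = κ u • covAlong Γ F (fun w => fderiv ℝ F w (L u)) u X := by
    rw [covAlong_fderiv_comm hF hΓs, covAlong_fderiv_comm hF hΓs X, map_smul]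
  rw [jacobiOperator_apply, curvatureForm_fderiv_of_covAlong_eq hF hV
      hW.differentiableAt_weingarten hΓ hW.covAlong_eq, hW.apply_field.self_of_nhds, h_cov_smul,
    covAlong_fderiv_comm hF hΓs (L u), h_cov, h_cov,
    eq_sub_of_add_eq (hW.fderiv_apply_field X)]
  simp only [riccatiMap, _root_.add_apply, _root_.sub_apply, _root_.smul_apply,
    ContinuousLinearMap.smulRight_apply, ContinuousLinearMap.comp_apply, map_add, map_sub,
    map_smul, smul_sub]
  abel

variable [FiniteDimensional ℝ D]

lemma trace_riccatiMap (hW : IsWeingartenAt Γ F L W κ u) :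
    LinearMap.trace ℝ D (riccatiMap L W κ u)
      = κ u * LinearMap.trace ℝ D (W u) - LinearMap.trace ℝ D ((W u : D →ₗ[ℝ] D) ∘ₗ W u)
        - fderiv ℝ (fun w => LinearMap.trace ℝ D (W w) - κ w) u (L u) := by
  let τ : (D →L[ℝ] D) →L[ℝ] ℝ :=
    LinearMap.toContinuousLinearMap (LinearMap.trace ℝ D ∘ₗ ContinuousLinearMap.coeLM ℝ)
  have h_deriv : fderiv ℝ (fun w => LinearMap.trace ℝ D (W w) - κ w) u (L u)
      = LinearMap.trace ℝ D (fderiv ℝ W u (L u)) - fderiv ℝ κ u (L u) := by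
    have h := (τ.hasFDerivAt.comp u hW.differentiableAt_weingarten.hasFDerivAt).sub
      hW.differentiableAt_gravity.hasFDerivAt
    exact DFunLike.congr_fun h.fderiv (L u)
  have h_comm := LinearMap.trace_comp_comm' (fderiv ℝ L u : D →ₗ[ℝ] D) (W u)
  have h_rank : LinearMap.trace ℝ D ((fderiv ℝ κ u).smulRight (L u) : D →L[ℝ] D)
      = fderiv ℝ κ u (L u) :=
    LinearMap.trace_smulRight _ _
  rw [h_deriv]
  simp only [riccatiMap, ContinuousLinearMap.toLinearMap_add, ContinuousLinearMap.toLinearMap_sub,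
    ContinuousLinearMap.toLinearMap_smul, ContinuousLinearMap.toLinearMap_comp, map_add, map_sub,
    map_smul, smul_eq_mul, h_comm, h_rank]
  ring

lemma trace_jacobiOperator [FiniteDimensional ℝ E] (hW : IsWeingartenAt Γ F L W κ u)
    (hΓ : DifferentiableAt ℝ Γ (F u)) (hΓs : ∀ v w, Γ (F u) v w = Γ (F u) w v)
    (hinj : Function.Injective (fderiv ℝ F u))
    (hr : ∀ z, jacobiOperator Γ (F u) (fderiv ℝ F u (L u)) z ∈ range (fderiv ℝ F u)) :
    LinearMap.trace ℝ E (jacobiOperator Γ (F u) (fderiv ℝ F u (L u)))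
      = κ u * LinearMap.trace ℝ D (W u) - LinearMap.trace ℝ D ((W u : D →ₗ[ℝ] D) ∘ₗ W u)
        - fderiv ℝ (fun w => LinearMap.trace ℝ D (W w) - κ w) u (L u) := by
  rw [← hW.trace_riccatiMap]
  exact trace_eq_of_injective_of_apply_eq hinj hr fun x =>
    hW.jacobiOperator_fderiv_apply hΓ hΓs x

end IsWeingartenAt

end CovariantCalculus

section NullImmersion

set_option maxSynthPendingDepth 3

open Filter Topology

variable {D E : Type*} [NormedAddCommGroup D] [NormedSpace ℝ D]
  [NormedAddCommGroup E] [NormedSpace ℝ E]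

lemma exists_contDiffAt_eventually_eq_comp {X D' : Type*} [NormedAddCommGroup X] [NormedSpace ℝ X]
    [NormedAddCommGroup D'] [NormedSpace ℝ D'] [CompleteSpace D] {m : WithTop ℕ∞}
    {A : X → D →L[ℝ] E} {N : X → D' →L[ℝ] E} {x : X} (hA : ContDiffAt ℝ m A x)
    (hN : ContDiffAt ℝ m N x) (hA' : (A x).HasLeftInverse)
    (h : ∀ᶠ y in 𝓝 x, range (N y) ⊆ range (A y)) :
    ∃ W : X → D' →L[ℝ] D, ContDiffAt ℝ m W x ∧ ∀ᶠ y in 𝓝 x, N y = A y ∘L W y := by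
  obtain ⟨P, hP⟩ := hA'
  have h_comp : ContDiffAt ℝ m (fun y => P ∘L A y) x := contDiffAt_const.clm_comp hA
  have h_one : P ∘L A x = ((1 : (D →L[ℝ] D)ˣ) : D →L[ℝ] D) := ContinuousLinearMap.ext hP
  have h_unit : ∀ᶠ y in 𝓝 x, IsUnit (P ∘L A y) :=
    h_comp.continuousAt.eventually (Units.isOpen.mem_nhds ⟨1, h_one.symm⟩)
  have h_inv : ContDiffAt ℝ m (fun y => Ring.inverse (P ∘L A y)) x :=
    ContDiffAt.comp x (g := Ring.inverse) (h_one ▸ contDiffAt_ringInverse ℝ _) h_comp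
  refine ⟨fun y => Ring.inverse (P ∘L A y) ∘L (P ∘L N y),
    h_inv.clm_comp (contDiffAt_const.clm_comp hN), ?_⟩
  filter_upwards [h, h_unit] with y hy hu
  ext z
  obtain ⟨z', hz'⟩ := hy ⟨z, rfl⟩
  have := DFunLike.congr_fun (Ring.inverse_mul_cancel _ hu) z'
  simp only [mul_apply_eq_comp, ContinuousLinearMap.comp_apply,
    one_apply_eq_self] at this ⊢
  rw [← hz', this]

lemma exists_contDiffAt_eventually_eq_smul {X : Type*} [NormedAddCommGroup X] [NormedSpace ℝ X]
    {m : WithTop ℕ∞} {v w : X → D} {x : X} (hv : ContDiffAt ℝ m v x) (hw : ContDiffAt ℝ m w x)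
    (hv0 : v x ≠ 0) (h : ∀ᶠ y in 𝓝 x, w y ∈ Submodule.span ℝ {v y}) :
    ∃ κ : X → ℝ, ContDiffAt ℝ m κ x ∧ ∀ᶠ y in 𝓝 x, w y = κ y • v y := by
  obtain ⟨φ, hφ⟩ := SeparatingDual.exists_ne_zero (R := ℝ) hv0
  have hφv : ContDiffAt ℝ m (fun y => φ (v y)) x := φ.contDiff.contDiffAt.comp x hv
  refine ⟨fun y => φ (w y) / φ (v y), (φ.contDiff.contDiffAt.comp x hw).div hφv hφ, ?_⟩
  filter_upwards [h, hφv.continuousAt.eventually_ne hφ] with y hy hy0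
  obtain ⟨c, hc⟩ := Submodule.mem_span_singleton.1 hy
  simp [← hc, hy0]

/-- Near the point with coordinates `u`, `F` is an immersion into a vector space with the Lorentzian
metric `g`, and `Γ` is the Christoffel form of the Levi-Civita connection of `g`. -/
structure IsLorentzImmersionAt (Γ : E → E →L[ℝ] E →L[ℝ] E) (g : E → E →L[ℝ] E →L[ℝ] ℝ)
    (F : D → E) (u : D) : Prop where
  contDiffAt : ContDiffAt ℝ 3 F u
  contDiffAt_metric : ContDiffAt ℝ 2 g (F u)
  contDiffAt_christoffel : ContDiffAt ℝ 1 Γ (F u)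
  torsion_free : ∀ᶠ y in 𝓝 (F u), ∀ v w, Γ y v w = Γ y w v
  parallel : ∀ᶠ y in 𝓝 (F u), IsParallelAt Γ g y
  lorentz : ∀ᶠ y in 𝓝 (F u), IsLorentzian (g y).toBilinForm
  injective : Function.Injective (fderiv ℝ F u)

/-- `L` is a field near `u` in the degeneracy directions of the pullback `F^* g`. -/
structure IsDegenerateFieldAt (g : E → E →L[ℝ] E →L[ℝ] ℝ) (F : D → E) (L : D → D) (u : D) :
    Prop where
  contDiffAt : ContDiffAt ℝ 2 L u
  orthogonal : ∀ᶠ v in 𝓝 u, ∀ Y, g (F v) (fderiv ℝ F v (L v)) (fderiv ℝ F v Y) = 0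

variable {Γ : E → E →L[ℝ] E →L[ℝ] E} {g : E → E →L[ℝ] E →L[ℝ] ℝ} {F : D → E} {L : D → D} {u : D}

namespace IsLorentzImmersionAt

lemma eventually_metric_symm (h : IsLorentzImmersionAt Γ g F u) :
    ∀ᶠ y in 𝓝 (F u), ∀ v w, g y v w = g y w v :=
  h.lorentz.mono fun _ hy => hy.isSymm.eq

lemma metric_symm (h : IsLorentzImmersionAt Γ g F u) (v w : E) : g (F u) v w = g (F u) w v :=
  h.eventually_metric_symm.self_of_nhds v w

lemma contDiffAt_fderiv_apply (h : IsLorentzImmersionAt Γ g F u) (hL : ContDiffAt ℝ 2 L u) :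
    ContDiffAt ℝ 2 (fun w => fderiv ℝ F w (L w)) u :=
  (h.contDiffAt.fderiv_right (m := 2) (by norm_num)).clm_apply hL

lemma fderiv_metric_fderiv_apply {L' : D → D} (h : IsLorentzImmersionAt Γ g F u)
    (hL : ContDiffAt ℝ 2 L u) (hL' : ContDiffAt ℝ 2 L' u) (X : D) :
    fderiv ℝ (fun w => g (F w) (fderiv ℝ F w (L w)) (fderiv ℝ F w (L' w))) u X
      = g (F u) (covAlong Γ F (fun w => fderiv ℝ F w (L w)) u X) (fderiv ℝ F u (L' u))
        + g (F u) (fderiv ℝ F u (L u)) (covAlong Γ F (fun w => fderiv ℝ F w (L' w)) u X) :=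
  fderiv_metric_apply (h.contDiffAt_metric.differentiableAt (by norm_num))
    (h.contDiffAt.differentiableAt (by norm_num))
    ((h.contDiffAt_fderiv_apply hL).differentiableAt (by norm_num))
    ((h.contDiffAt_fderiv_apply hL').differentiableAt (by norm_num)) h.parallel.self_of_nhds X

lemma covAlong_comm (h : IsLorentzImmersionAt Γ g F u) (X Y : D) :
    covAlong Γ F (fun w => fderiv ℝ F w Y) u X = covAlong Γ F (fun w => fderiv ℝ F w X) u Y :=
  covAlong_fderiv_comm (h.contDiffAt.of_le (by norm_num)) h.torsion_free.self_of_nhds X Y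

lemma contDiffAt_covAlong (h : IsLorentzImmersionAt Γ g F u) (hL : ContDiffAt ℝ 2 L u) :
    ContDiffAt ℝ 1 (covAlong Γ F fun w => fderiv ℝ F w (L w)) u := by
  have hV := h.contDiffAt_fderiv_apply hL
  have hΓ : ContDiffAt ℝ 1 (fun w => Γ (F w)) u :=
    h.contDiffAt_christoffel.comp u (h.contDiffAt.of_le (by norm_num))
  have hΓ' : ContDiffAt ℝ 1 (fun w => (Γ (F w)).flip) u :=
    (ContinuousLinearMap.flipₗᵢ ℝ E E E).contDiff.contDiffAt.comp u hΓ
  exact (hV.fderiv_right (by norm_num)).add ((hΓ'.clm_apply (hV.of_le (by norm_num))).clm_comp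
    (h.contDiffAt.fderiv_right (by norm_num)))

lemma eventually [FiniteDimensional ℝ D] (h : IsLorentzImmersionAt Γ g F u) :
    ∀ᶠ v in 𝓝 u, IsLorentzImmersionAt Γ g F v := by
  have hF := h.contDiffAt.continuousAt
  have hF' : ContinuousAt (fderiv ℝ F) u :=
    (h.contDiffAt.fderiv_right (m := 0) (by norm_num)).continuousAt
  filter_upwards [h.contDiffAt.eventually (by decide),
    hF.eventually (h.contDiffAt_metric.eventually (by decide)),
    hF.eventually (h.contDiffAt_christoffel.eventually (by decide)),
    hF.eventually h.torsion_free.eventually_nhds, hF.eventually h.parallel.eventually_nhds,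
    hF.eventually h.lorentz.eventually_nhds,
    hF'.eventually (ContinuousLinearMap.isOpen_injective.mem_nhds h.injective)]
    with v h1 h2 h3 h4 h5 h6 h7 using ⟨h1, h2, h3, h4, h5, h6, h7⟩

end IsLorentzImmersionAt

namespace IsDegenerateFieldAt

lemma eventually (hL : IsDegenerateFieldAt g F L u) : ∀ᶠ v in 𝓝 u, IsDegenerateFieldAt g F L v := by
  filter_upwards [hL.contDiffAt.eventually (by decide), hL.orthogonal.eventually_nhds]
    with v h1 h2 using ⟨h1, h2⟩

lemma metric_covAlong (hL : IsDegenerateFieldAt g F L u) (h : IsLorentzImmersionAt Γ g F u)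
    (X Y : D) :
    g (F u) (covAlong Γ F (fun w => fderiv ℝ F w (L w)) u X) (fderiv ℝ F u Y)
      = -g (F u) (fderiv ℝ F u (L u)) (covAlong Γ F (fun w => fderiv ℝ F w Y) u X) := by
  have h_zero : (fun v => g (F v) (fderiv ℝ F v (L v)) (fderiv ℝ F v Y)) =ᶠ[𝓝 u] 0 :=
    hL.orthogonal.mono fun v hv => hv Y
  rw [eq_neg_iff_add_eq_zero, ← h.fderiv_metric_fderiv_apply hL.contDiffAt contDiffAt_const X,
    h_zero.fderiv_eq, fderiv_zero]
  simp

lemma metric_covAlong_symm (hL : IsDegenerateFieldAt g F L u) (h : IsLorentzImmersionAt Γ g F u)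
    (X Y : D) :
    g (F u) (covAlong Γ F (fun w => fderiv ℝ F w (L w)) u X) (fderiv ℝ F u Y)
      = g (F u) (covAlong Γ F (fun w => fderiv ℝ F w (L w)) u Y) (fderiv ℝ F u X) := by
  rw [hL.metric_covAlong h, hL.metric_covAlong h, h.covAlong_comm]

lemma metric_covAlong_self (hL : IsDegenerateFieldAt g F L u) (h : IsLorentzImmersionAt Γ g F u)
    (X : D) :
    g (F u) (fderiv ℝ F u (L u)) (covAlong Γ F (fun w => fderiv ℝ F w (L w)) u X) = 0 := by
  have h_zero : (fun v => g (F v) (fderiv ℝ F v (L v)) (fderiv ℝ F v (L v))) =ᶠ[𝓝 u] 0 :=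
    hL.orthogonal.mono fun v hv => hv _
  have h_deriv := h.fderiv_metric_fderiv_apply hL.contDiffAt hL.contDiffAt X
  rw [h_zero.fderiv_eq, fderiv_zero, h.metric_symm (covAlong _ _ _ _ _)] at h_deriv
  simp only [Pi.zero_apply, _root_.zero_apply] at h_deriv
  linarith

lemma lieDerivative (hL : IsDegenerateFieldAt g F L u) (h : IsLorentzImmersionAt Γ g F u)
    (X Y : D) :
    fderiv ℝ (fun w => g (F w) (fderiv ℝ F w X) (fderiv ℝ F w Y)) u (L u)
      + g (F u) (fderiv ℝ F u (fderiv ℝ L u X)) (fderiv ℝ F u Y)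
      + g (F u) (fderiv ℝ F u X) (fderiv ℝ F u (fderiv ℝ L u Y))
      = 2 * g (F u) (covAlong Γ F (fun w => fderiv ℝ F w (L w)) u X) (fderiv ℝ F u Y) := by
  have h_split (X : D) : covAlong Γ F (fun w => fderiv ℝ F w (L w)) u X
      = covAlong Γ F (fun w => fderiv ℝ F w X) u (L u) + fderiv ℝ F u (fderiv ℝ L u X) := by
    rw [covAlong_fderiv_apply (h.contDiffAt.of_le (by norm_num))
      (hL.contDiffAt.differentiableAt (by norm_num)), h.covAlong_comm]
  have h_symm := hL.metric_covAlong_symm h X Y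
  rw [h.metric_symm (covAlong Γ F _ u Y)] at h_symm
  rw [h.fderiv_metric_fderiv_apply (L := fun _ => X) (L' := fun _ => Y) contDiffAt_const
    contDiffAt_const]
  simp only [h_split, map_add, _root_.add_apply] at h_symm ⊢
  linarith

lemma eventually_ne_zero (hL : IsDegenerateFieldAt g F L u) (h0 : L u ≠ 0) :
    ∀ᶠ v in 𝓝 u, L v ≠ 0 :=
  hL.contDiffAt.continuousAt.eventually_ne h0

lemma ker_comp_eq_span (hL : IsDegenerateFieldAt g F L u) (h : IsLorentzImmersionAt Γ g F u)
    (h0 : L u ≠ 0) :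
    LinearMap.ker ((g (F u)).toBilinForm.comp (fderiv ℝ F u : D →ₗ[ℝ] E) (fderiv ℝ F u))
      = Submodule.span ℝ {L u} :=
  h.lorentz.self_of_nhds.ker_comp_eq_span h.injective h0 hL.orthogonal.self_of_nhds

lemma isPosSemidef_comp (hL : IsDegenerateFieldAt g F L u) (h : IsLorentzImmersionAt Γ g F u)
    (h0 : L u ≠ 0) :
    ((g (F u)).toBilinForm.comp (fderiv ℝ F u : D →ₗ[ℝ] E) (fderiv ℝ F u)).IsPosSemidef :=
  h.lorentz.self_of_nhds.isPosSemidef_comp h.injective h0 hL.orthogonal.self_of_nhds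

variable [FiniteDimensional ℝ E]

lemma mem_range_of_metric_eq_zero (hL : IsDegenerateFieldAt g F L u)
    (h : IsLorentzImmersionAt Γ g F u) (hdim : finrank ℝ E = finrank ℝ D + 1) (h0 : L u ≠ 0)
    {z : E} (hz : g (F u) (fderiv ℝ F u (L u)) z = 0) : z ∈ range (fderiv ℝ F u) :=
  h.lorentz.self_of_nhds.mem_range_of_apply_eq_zero hdim h.injective h0
    hL.orthogonal.self_of_nhds hz

variable [FiniteDimensional ℝ D]

lemma exists_isWeingartenAt (hL : IsDegenerateFieldAt g F L u) (h : IsLorentzImmersionAt Γ g F u)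
    (hdim : finrank ℝ E = finrank ℝ D + 1) (h0 : L u ≠ 0) :
    ∃ W κ, IsWeingartenAt Γ F L W κ u := by
  have h_near := h.eventually.and (hL.eventually.and (hL.eventually_ne_zero h0))
  obtain ⟨W, hW, hW_eq⟩ := exists_contDiffAt_eventually_eq_comp
    (h.contDiffAt.fderiv_right (m := 1) (by norm_num)) (h.contDiffAt_covAlong hL.contDiffAt)
    (.of_injective_of_finiteDimensional h.injective) <| by
      filter_upwards [h_near] with v ⟨hv, hLv, hv0⟩
      rintro _ ⟨X, rfl⟩
      exact hLv.mem_range_of_metric_eq_zero hv hdim hv0 (hLv.metric_covAlong_self hv X)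
  have hL1 : ContDiffAt ℝ 1 L u := hL.contDiffAt.of_le (by norm_num)
  obtain ⟨κ, hκ, hκ_eq⟩ := exists_contDiffAt_eventually_eq_smul hL1 (hW.clm_apply hL1) h0 <| by
    filter_upwards [h_near, hW_eq] with v ⟨hv, hLv, hv0⟩ hWv
    rw [← hLv.ker_comp_eq_span hv hv0]
    ext Y
    have h_eq := hLv.metric_covAlong_symm hv (L v) Y
    rw [hv.metric_symm (covAlong _ _ _ _ Y), hLv.metric_covAlong_self hv, hWv] at h_eq
    exact h_eq
  exact ⟨W, κ, h.contDiffAt, hL.contDiffAt, hW.differentiableAt (by norm_num),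
    hκ.differentiableAt (by norm_num), hW_eq, hκ_eq⟩

variable {W : D → D →L[ℝ] D} {κ : D → ℝ}

lemma trace_jacobiOperator (hL : IsDegenerateFieldAt g F L u)
    (h : IsLorentzImmersionAt Γ g F u) (hdim : finrank ℝ E = finrank ℝ D + 1) (h0 : L u ≠ 0)
    (hW : IsWeingartenAt Γ F L W κ u) (hθ : ∀ᶠ v in 𝓝 u, LinearMap.trace ℝ D (W v) = κ v) :
    LinearMap.trace ℝ E (jacobiOperator Γ (F u) (fderiv ℝ F u (L u)))
      = κ u ^ 2 - LinearMap.trace ℝ D ((W u : D →ₗ[ℝ] D) ∘ₗ W u) := by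
  have h_expansion : (fun v => LinearMap.trace ℝ D (W v) - κ v) =ᶠ[𝓝 u] 0 :=
    hθ.mono fun v hv => sub_eq_zero.2 hv
  have hΓ := h.contDiffAt_christoffel.differentiableAt (by norm_num)
  rw [hW.trace_jacobiOperator hΓ h.torsion_free.self_of_nhds h.injective fun z =>
      hL.mem_range_of_metric_eq_zero h hdim h0 <| by
        rw [h.metric_symm, jacobiOperator_apply]
        exact metric_curvatureForm_self h.contDiffAt_metric h.eventually_metric_symm hΓ h.parallel
          _ _ _,
    h_expansion.fderiv_eq, hθ.self_of_nhds, fderiv_zero]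
  simp [sq]

lemma trace_jacobiOperator_nonpos (hL : IsDegenerateFieldAt g F L u)
    (h : IsLorentzImmersionAt Γ g F u) (hdim : finrank ℝ E = finrank ℝ D + 1) (h0 : L u ≠ 0)
    (hW : IsWeingartenAt Γ F L W κ u) (hθ : ∀ᶠ v in 𝓝 u, LinearMap.trace ℝ D (W v) = κ v) :
    LinearMap.trace ℝ E (jacobiOperator Γ (F u) (fderiv ℝ F u (L u))) ≤ 0 ∧
      (LinearMap.trace ℝ E (jacobiOperator Γ (F u) (fderiv ℝ F u (L u))) = 0 → ∀ X Y,
        g (F u) (covAlong Γ F (fun w => fderiv ℝ F w (L w)) u X) (fderiv ℝ F u Y) = 0) := by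
  set q := (g (F u)).toBilinForm.comp (fderiv ℝ F u : D →ₗ[ℝ] E) (fderiv ℝ F u)
  have h_ker : LinearMap.ker q = Submodule.span ℝ {L u} := hL.ker_comp_eq_span h h0
  have h_cov (X Y : D) : q (W u X) Y
      = g (F u) (covAlong Γ F (fun w => fderiv ℝ F w (L w)) u X) (fderiv ℝ F u Y) := by
    rw [hW.covAlong_eq.self_of_nhds]
    rfl
  have h_posSemidef : q.IsPosSemidef := hL.isPosSemidef_comp h h0
  have h_self_adjoint (X Y : D) : q (W u X) Y = q X (W u Y) := by
    rw [h_cov, hL.metric_covAlong_symm h, ← h_cov, h_posSemidef.isSymm.eq]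
  have h_gravity : ∀ X ∈ LinearMap.ker q, (W u : D →ₗ[ℝ] D) X = κ u • X := by
    rw [h_ker]
    intro X hX
    obtain ⟨c, rfl⟩ := Submodule.mem_span_singleton.1 hX
    rw [map_smul, ContinuousLinearMap.coe_coe, hW.apply_field.self_of_nhds, smul_comm]
  obtain ⟨h_le, h_eq⟩ := sq_le_trace_comp_self h_posSemidef
    (by rw [h_ker, finrank_span_singleton h0]) h_self_adjoint h_gravity
  rw [hL.trace_jacobiOperator h hdim h0 hW hθ]
  refine ⟨sub_nonpos.2 h_le, fun h_trace X Y => ?_⟩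
  rw [← h_cov]
  exact h_eq (sub_eq_zero.1 h_trace).symm X Y

end IsDegenerateFieldAt

end NullImmersion

section Christoffel

set_option maxSynthPendingDepth 3

open Filter Topology

section Matrix

variable {X ι : Type*} [NormedAddCommGroup X] [NormedSpace ℝ X] [Fintype ι] [DecidableEq ι]
  {A : X → Matrix ι ι ℝ} {x : X} {m : WithTop ℕ∞}

lemma contDiffAt_matrix_det (hA : ∀ i j, ContDiffAt ℝ m (fun u => A u i j) x) :
    ContDiffAt ℝ m (fun u => (A u).det) x := by
  simp only [Matrix.det_apply]
  exact ContDiffAt.sum fun σ _ => (contDiffAt_prod fun i _ => hA _ _).const_smul _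

lemma contDiffAt_matrix_inv (hA : ∀ i j, ContDiffAt ℝ m (fun u => A u i j) x)
    (hx : (A x).det ≠ 0) (i j : ι) : ContDiffAt ℝ m (fun u => (A u)⁻¹ i j) x := by
  simp only [Matrix.inv_def, Ring.inverse_eq_inv', Matrix.smul_apply, smul_eq_mul,
    Matrix.adjugate_apply]
  refine ((contDiffAt_matrix_det hA).inv hx).mul (contDiffAt_matrix_det fun a b => ?_)
  obtain rfl | h := eq_or_ne a j
  · simpa using contDiffAt_const
  · simpa [Matrix.updateRow_ne h] using hA a b

end Matrix

variable {n : ℕ}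

lemma sum_smul_single (v : 𝔼 n) : ∑ i, v i • EuclideanSpace.single i (1 : ℝ) = v := by
  simpa using (EuclideanSpace.basisFun (Fin n) ℝ).sum_repr v

lemma trace_eq_sum_apply_single (f : 𝔼 n →ₗ[ℝ] 𝔼 n) :
    LinearMap.trace ℝ (𝔼 n) f = ∑ k, f (EuclideanSpace.single k 1) k := by
  simp [LinearMap.trace_eq_matrix_trace ℝ (EuclideanSpace.basisFun (Fin n) ℝ).toBasis,
    Matrix.trace, LinearMap.toMatrix_apply]

lemma induction_single {p : 𝔼 n → Prop} (hzero : p 0)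
    (hadd : ∀ (c : ℝ) v w, p v → p w → p (c • v + w))
    (hsingle : ∀ i, p (EuclideanSpace.single i 1)) (v : 𝔼 n) : p v := by
  rw [← sum_smul_single v]
  induction (Finset.univ : Finset (Fin n)) using Finset.induction_on with
  | empty => exact hzero
  | insert i s hi ih => rw [Finset.sum_insert hi]; exact hadd _ _ _ (hsingle i) ih

/-- The bilinear form with matrix `G x`. -/
noncomputable def matrixForm (G : 𝔼 n → Matrix (Fin n) (Fin n) ℝ) (x : 𝔼 n) :
    𝔼 n →L[ℝ] 𝔼 n →L[ℝ] ℝ :=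
  ∑ i, ∑ j, G x i j • (EuclideanSpace.proj i : 𝔼 n →L[ℝ] ℝ).smulRight
    (EuclideanSpace.proj j : 𝔼 n →L[ℝ] ℝ)

/-- The bilinear map whose components are the Christoffel symbols of `G`. -/
noncomputable def christoffelForm (G : 𝔼 n → Matrix (Fin n) (Fin n) ℝ) (x : 𝔼 n) :
    𝔼 n →L[ℝ] 𝔼 n →L[ℝ] 𝔼 n :=
  ∑ k, ∑ i, ∑ j, christoffel G k i j x • (EuclideanSpace.proj i : 𝔼 n →L[ℝ] ℝ).smulRight
    ((EuclideanSpace.proj j : 𝔼 n →L[ℝ] ℝ).smulRight (EuclideanSpace.single k (1 : ℝ)))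

lemma matrixForm_apply (G : 𝔼 n → Matrix (Fin n) (Fin n) ℝ) (x v w : 𝔼 n) :
    matrixForm G x v w = ∑ i, ∑ j, G x i j * v i * w j := by
  simp [matrixForm, mul_assoc]

lemma matrixForm_single (G : 𝔼 n → Matrix (Fin n) (Fin n) ℝ) (x : 𝔼 n) (i j : Fin n) :
    matrixForm G x (EuclideanSpace.single i 1) (EuclideanSpace.single j 1) = G x i j := by
  simp [matrixForm_apply]

lemma christoffelForm_apply (G : 𝔼 n → Matrix (Fin n) (Fin n) ℝ) (x v w : 𝔼 n) (k : Fin n) :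
    christoffelForm G x v w k = ∑ i, ∑ j, christoffel G k i j x * v i * w j := by
  simp [christoffelForm, mul_assoc, Finset.sum_apply, Pi.single_apply]

variable {G : 𝔼 n → Matrix (Fin n) (Fin n) ℝ} {x : 𝔼 n}

lemma contDiffAt_matrixForm {m : WithTop ℕ∞} (hG : ∀ i j, ContDiffAt ℝ m (fun u => G u i j) x) :
    ContDiffAt ℝ m (matrixForm G) x :=
  ContDiffAt.sum fun i _ => ContDiffAt.sum fun j _ => (hG i j).smul contDiffAt_const

lemma contDiffAt_christoffel {m k : WithTop ℕ∞} (hG : ∀ i j, ContDiffAt ℝ m (fun u => G u i j) x)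
    (hk : k + 1 ≤ m) (hx : (G x).det ≠ 0) (a i j : Fin n) :
    ContDiffAt ℝ k (christoffel G a i j) x := by
  have h_partial (i a b : Fin n) : ContDiffAt ℝ k (partialDeriv i fun u => G u a b) x :=
    ((hG a b).fderiv_right hk).clm_apply contDiffAt_const
  exact contDiffAt_const.mul <| ContDiffAt.sum fun l _ =>
    ((contDiffAt_matrix_inv hG hx a l).of_le (le_self_add.trans hk)).mul
      (((h_partial _ _ _).add (h_partial _ _ _)).sub (h_partial _ _ _))

lemma contDiffAt_christoffelForm {m k : WithTop ℕ∞}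
    (hG : ∀ i j, ContDiffAt ℝ m (fun u => G u i j) x) (hk : k + 1 ≤ m) (hx : (G x).det ≠ 0) :
    ContDiffAt ℝ k (christoffelForm G) x :=
  ContDiffAt.sum fun a _ => ContDiffAt.sum fun i _ => ContDiffAt.sum fun j _ =>
    (contDiffAt_christoffel hG hk hx a i j).smul contDiffAt_const

lemma matrixForm_comm (hGs : (G x).IsSymm) (v w : 𝔼 n) :
    matrixForm G x v w = matrixForm G x w v := by
  rw [matrixForm_apply, matrixForm_apply, Finset.sum_comm]
  refine Finset.sum_congr rfl fun i _ => Finset.sum_congr rfl fun j _ => ?_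
  rw [hGs.apply]
  ring

lemma partialDeriv_comm (hGs : ∀ᶠ u in 𝓝 x, (G u).IsSymm) (k i j : Fin n) :
    partialDeriv k (fun u => G u i j) x = partialDeriv k (fun u => G u j i) x := by
  have h : (fun u => G u i j) =ᶠ[𝓝 x] fun u => G u j i := hGs.mono fun u hu => hu.apply j i
  rw [partialDeriv, partialDeriv, h.fderiv_eq]

lemma christoffel_comm (hGs : ∀ᶠ u in 𝓝 x, (G u).IsSymm) (k i j : Fin n) :
    christoffel G k i j x = christoffel G k j i x := by
  simp only [christoffel, partialDeriv_comm hGs _ i j,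
    add_comm (partialDeriv i _ x) (partialDeriv j _ x)]

lemma christoffelForm_comm (hGs : ∀ᶠ u in 𝓝 x, (G u).IsSymm) (v w : 𝔼 n) :
    christoffelForm G x v w = christoffelForm G x w v := by
  ext k
  rw [christoffelForm_apply, christoffelForm_apply, Finset.sum_comm]
  refine Finset.sum_congr rfl fun j _ => Finset.sum_congr rfl fun i _ => ?_
  rw [christoffel_comm hGs]
  ring

lemma fderiv_matrixForm_single (hG : DifferentiableAt ℝ (matrixForm G) x) (k i j : Fin n) :
    fderiv ℝ (matrixForm G) x (EuclideanSpace.single k 1) (EuclideanSpace.single i 1)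
      (EuclideanSpace.single j 1) = partialDeriv k (fun u => G u i j) x := by
  rw [← fderiv_clm_apply_const hG, ← fderiv_clm_apply_const
    (hG.clm_apply (differentiableAt_const _))]
  simp only [matrixForm_single, partialDeriv]

lemma sum_mul_christoffel (hx : (G x).det ≠ 0) (i j l : Fin n) :
    ∑ k, G x l k * christoffel G k i j x
      = (1 / 2) * (partialDeriv i (fun w => G w j l) x + partialDeriv j (fun w => G w i l) x
        - partialDeriv l (fun w => G w i j) x) := by
  let t : Fin n → ℝ := fun l => partialDeriv i (fun w => G w j l) x
    + partialDeriv j (fun w => G w i l) x - partialDeriv l (fun w => G w i j) x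
  have h : (G x).mulVec ((1 / 2 : ℝ) • (G x)⁻¹.mulVec t) = (1 / 2 : ℝ) • t := by
    rw [Matrix.mulVec_smul, Matrix.mulVec_mulVec,
      Matrix.mul_nonsing_inv _ (isUnit_iff_ne_zero.2 hx), Matrix.one_mulVec]
  exact congrFun h l

lemma matrixForm_christoffelForm (hG : DifferentiableAt ℝ (matrixForm G) x) (hx : (G x).det ≠ 0)
    (v w z : 𝔼 n) :
    matrixForm G x z (christoffelForm G x v w)
      = (1 / 2) * (fderiv ℝ (matrixForm G) x v w z + fderiv ℝ (matrixForm G) x w v z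
        - fderiv ℝ (matrixForm G) x z v w) := by
  induction v using induction_single with
  | hzero => simp
  | hadd c a b ha hb =>
    simp only [map_add, map_smul, _root_.add_apply, _root_.smul_apply, smul_eq_mul, ha, hb]
    ring
  | hsingle i =>
  induction w using induction_single with
  | hzero => simp
  | hadd c a b ha hb =>
    simp only [map_add, map_smul, _root_.add_apply, _root_.smul_apply, smul_eq_mul, ha, hb]
    ring
  | hsingle j =>
  induction z using induction_single with
  | hzero => simp
  | hadd c a b ha hb =>
    simp only [map_add, map_smul, _root_.add_apply, _root_.smul_apply, smul_eq_mul, ha, hb]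
    ring
  | hsingle l =>
  simp only [fderiv_matrixForm_single hG, ← sum_mul_christoffel hx]
  simp [matrixForm_apply, christoffelForm_apply]

lemma fderiv_matrixForm_comm (hG : DifferentiableAt ℝ (matrixForm G) x)
    (hGs : ∀ᶠ u in 𝓝 x, (G u).IsSymm) (z v w : 𝔼 n) :
    fderiv ℝ (matrixForm G) x z v w = fderiv ℝ (matrixForm G) x z w v := by
  have h : (fun u => matrixForm G u v w) =ᶠ[𝓝 x] fun u => matrixForm G u w v :=
    hGs.mono fun u hu => matrixForm_comm hu v w
  have h_apply (v w : 𝔼 n) :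
      fderiv ℝ (matrixForm G) x z v w = fderiv ℝ (fun u => matrixForm G u v w) x z := by
    rw [fderiv_clm_apply_const (hG.clm_apply (differentiableAt_const v)),
      fderiv_clm_apply_const hG]
  rw [h_apply, h_apply, h.fderiv_eq]

lemma isParallelAt_christoffelForm (hG : DifferentiableAt ℝ (matrixForm G) x)
    (hGs : ∀ᶠ u in 𝓝 x, (G u).IsSymm) (hx : (G x).det ≠ 0) :
    IsParallelAt (christoffelForm G) (matrixForm G) x := by
  intro z v w
  rw [matrixForm_comm hGs.self_of_nhds _ w, matrixForm_christoffelForm hG hx,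
    matrixForm_christoffelForm hG hx, fderiv_matrixForm_comm hG hGs z w v]
  ring

lemma curvatureForm_christoffelForm_single (hΓ : DifferentiableAt ℝ (christoffelForm G) x)
    (i j l k : Fin n) :
    curvatureForm (christoffelForm G) x (EuclideanSpace.single i 1) (EuclideanSpace.single j 1)
      (EuclideanSpace.single l 1) k = riemannCoord G k l i j x := by
  have h_fderiv (i j l : Fin n) : fderiv ℝ (christoffelForm G) x (EuclideanSpace.single i 1)
      (EuclideanSpace.single j 1) (EuclideanSpace.single l 1) k
      = partialDeriv i (christoffel G k j l) x := by
    have h_comp : (fun y => christoffelForm G y (EuclideanSpace.single j 1)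
        (EuclideanSpace.single l 1) k) = christoffel G k j l := by
      ext y
      simp [christoffelForm_apply]
    have hj := hΓ.clm_apply (differentiableAt_const (EuclideanSpace.single j (1 : ℝ)))
    have hjl := hj.clm_apply (differentiableAt_const (EuclideanSpace.single l (1 : ℝ)))
    rw [← fderiv_clm_apply_const hΓ, ← fderiv_clm_apply_const hj, partialDeriv, ← h_comp]
    exact (DFunLike.congr_fun ((EuclideanSpace.proj k : 𝔼 n →L[ℝ] ℝ).hasFDerivAt.comp x
      hjl.hasFDerivAt).fderiv _).symm
  rw [curvatureForm_apply, PiLp.add_apply, PiLp.sub_apply, PiLp.sub_apply, h_fderiv, h_fderiv,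
    riemannCoord, Finset.sum_sub_distrib]
  simp [christoffelForm_apply]

lemma sum_ricciCoord_eq_trace_jacobiOperator (hΓ : DifferentiableAt ℝ (christoffelForm G) x)
    (v : 𝔼 n) :
    ∑ l, ∑ j, ricciCoord G l j x * v l * v j
      = LinearMap.trace ℝ (𝔼 n) (jacobiOperator (christoffelForm G) x v) := by
  have h_diag (k : Fin n) : jacobiOperator (christoffelForm G) x v (EuclideanSpace.single k 1) k
      = ∑ l, ∑ j, riemannCoord G k l k j x * v l * v j := by
    rw [jacobiOperator_apply]
    conv_lhs => rw [← sum_smul_single v]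
    simp only [map_sum, map_smul, _root_.sum_apply, _root_.smul_apply, WithLp.ofLp_sum,
      WithLp.ofLp_smul, Finset.sum_apply, Pi.smul_apply, smul_eq_mul,
      curvatureForm_christoffelForm_single hΓ, Finset.mul_sum]
    exact Finset.sum_congr rfl fun l _ => Finset.sum_congr rfl fun j _ => by ring
  simp only [trace_eq_sum_apply_single, ContinuousLinearMap.coe_coe, h_diag, ricciCoord,
    Finset.sum_mul]
  exact Finset.sum_comm_cycle

end Christoffel

section Charts

set_option maxSynthPendingDepth 3

open Filter Topology

variable {n : ℕ} {M : Type*} [TopologicalSpace M] [ChartedSpace (𝔼 n) M] {c x : M} {u : 𝔼 n}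

/-- The tangent vector at the point with coordinates `u` in the preferred chart around `c`, as a
function of its components: the inverse of `vecCoord`. -/
noncomputable def coordLift (c : M) (u : 𝔼 n) :
    𝔼 n →L[ℝ] TangentSpace (𝓡 n) ((extChartAt (𝓡 n) c).symm u) :=
  mfderiv 𝓘(ℝ, 𝔼 n) (𝓡 n) (extChartAt (𝓡 n) c).symm u

/-- The components of a vector field in the preferred chart around `c`, as functions of the
coordinates. -/
noncomputable def fieldCoord (c : M) (ℓ : ∀ x : M, TangentSpace (𝓡 n) x) (u : 𝔼 n) : 𝔼 n :=
  vecCoord c ((extChartAt (𝓡 n) c).symm u) (ℓ ((extChartAt (𝓡 n) c).symm u))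

lemma fieldCoord_extChartAt (hx : x ∈ (extChartAt (𝓡 n) c).source)
    (ℓ : ∀ x : M, TangentSpace (𝓡 n) x) :
    fieldCoord c ℓ (extChartAt (𝓡 n) c x) = vecCoord c x (ℓ x) :=
  congrArg (fun y => vecCoord c y (ℓ y)) ((extChartAt (𝓡 n) c).left_inv hx)

lemma vecCoord_smul (c x : M) (r : ℝ) (v : TangentSpace (𝓡 n) x) :
    vecCoord c x (r • v) = r • vecCoord c x v :=
  map_smul (mfderiv (𝓡 n) 𝓘(ℝ, 𝔼 n) (extChartAt (𝓡 n) c) x) r v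

lemma matrixForm_formCoord (h : ∀ x : M, TangentSpace (𝓡 n) x →L[ℝ] TangentSpace (𝓡 n) x →L[ℝ] ℝ)
    (c : M) (u v w : 𝔼 n) :
    matrixForm (formCoord h c) u v w
      = h ((extChartAt (𝓡 n) c).symm u) (coordLift c u v) (coordLift c u w) := by
  induction v using induction_single with
  | hzero => simp only [map_zero, _root_.zero_apply]
  | hadd r a b ha hb => simp only [map_add, map_smul, _root_.add_apply, _root_.smul_apply, ha, hb]
  | hsingle i =>
  induction w using induction_single with
  | hzero => simp only [map_zero]
  | hadd r a b ha hb => simp only [map_add, map_smul, ha, hb]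
  | hsingle j => exact matrixForm_single _ _ _ _

section Smooth

variable [IsManifold (𝓡 n) 1 M]

/-- The components of tangent vectors in the preferred chart around `c`, as an equivalence. -/
noncomputable def vecCoordEquiv (hx : x ∈ (extChartAt (𝓡 n) c).source) :
    TangentSpace (𝓡 n) x ≃ₗ[ℝ] 𝔼 n :=
  LinearEquiv.ofBijective (mfderiv (𝓡 n) 𝓘(ℝ, 𝔼 n) (extChartAt (𝓡 n) c) x).toLinearMap
    (isInvertible_mfderiv_extChartAt hx).bijective

lemma fieldCoord_extChartAt_ne_zero {ℓ : ∀ x : M, TangentSpace (𝓡 n) x}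
    (hx : x ∈ (extChartAt (𝓡 n) c).source) (h0 : ℓ x ≠ 0) :
    fieldCoord c ℓ (extChartAt (𝓡 n) c x) ≠ 0 := by
  rw [fieldCoord_extChartAt hx]
  exact (map_ne_zero_iff _ (vecCoordEquiv hx).injective).2 h0

lemma vecCoord_coordLift (hu : u ∈ (extChartAt (𝓡 n) c).target) (v : 𝔼 n) :
    vecCoord c ((extChartAt (𝓡 n) c).symm u) (coordLift c u v) = v := by
  have h := mfderiv_extChartAt_comp_mfderivWithin_extChartAt_symm (I := 𝓡 n) hu
  rw [ModelWithCorners.range_eq_univ, mfderivWithin_univ] at h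
  exact DFunLike.congr_fun h v

lemma coordLift_vecCoord (hu : u ∈ (extChartAt (𝓡 n) c).target)
    (v : TangentSpace (𝓡 n) ((extChartAt (𝓡 n) c).symm u)) :
    coordLift c u (vecCoord c ((extChartAt (𝓡 n) c).symm u) v) = v := by
  have h := mfderivWithin_extChartAt_symm_comp_mfderiv_extChartAt (I := 𝓡 n) hu
  rw [ModelWithCorners.range_eq_univ, mfderivWithin_univ] at h
  exact DFunLike.congr_fun h v

lemma matrixForm_formCoord_vecCoord
    (h : ∀ x : M, TangentSpace (𝓡 n) x →L[ℝ] TangentSpace (𝓡 n) x →L[ℝ] ℝ)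
    (hx : x ∈ (extChartAt (𝓡 n) c).source) (v w : TangentSpace (𝓡 n) x) :
    matrixForm (formCoord h c) (extChartAt (𝓡 n) c x) (vecCoord c x v) (vecCoord c x w)
      = h x v w := by
  obtain ⟨u, hu, rfl⟩ := (extChartAt (𝓡 n) c).symm.surjOn hx
  rw [(extChartAt (𝓡 n) c).right_inv hu, matrixForm_formCoord, coordLift_vecCoord hu,
    coordLift_vecCoord hu]

end Smooth

variable [IsManifold (𝓡 n) ∞ M]

lemma contMDiffAt_extChartAt_symm (hu : u ∈ (extChartAt (𝓡 n) c).target) :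
    ContMDiffAt 𝓘(ℝ, 𝔼 n) (𝓡 n) ∞ (extChartAt (𝓡 n) c).symm u :=
  (contMDiffOn_extChartAt_symm c).contMDiffAt ((isOpen_extChartAt_target c).mem_nhds hu)

lemma contMDiffAt_coordLift (hu : u ∈ (extChartAt (𝓡 n) c).target) (v : 𝔼 n) :
    ContMDiffAt 𝓘(ℝ, 𝔼 n) (𝓡 n).tangent ∞
      (fun u => (⟨(extChartAt (𝓡 n) c).symm u, coordLift c u v⟩ : TangentBundle (𝓡 n) M)) u := by
  have h_open : IsOpen (extChartAt (𝓡 n) c).target := isOpen_extChartAt_target c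
  have h_tangent := (contMDiffOn_extChartAt_symm (I := 𝓡 n) (n := ∞) c).contMDiffOn_tangentMapWithin
    (m := ∞) (by simp) h_open.uniqueMDiffOn
  have h_const : ContMDiffOn 𝓘(ℝ, 𝔼 n) 𝓘(ℝ, 𝔼 n).tangent ∞
      (fun u => (⟨u, v⟩ : TangentBundle 𝓘(ℝ, 𝔼 n) (𝔼 n))) (extChartAt (𝓡 n) c).target :=
    contMDiffOn_vectorSpace_iff_contDiffOn.2 contDiffOn_const
  refine ((h_tangent.comp h_const fun u hu => hu).contMDiffAt
    (h_open.mem_nhds hu)).congr_of_eventuallyEq ?_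
  filter_upwards [h_open.mem_nhds hu] with w hw
  rw [Function.comp_apply, tangentMapWithin, mfderivWithin_of_isOpen h_open hw]
  rfl

lemma contDiffAt_formCoord {h : ∀ x : M, TangentSpace (𝓡 n) x →L[ℝ] TangentSpace (𝓡 n) x →L[ℝ] ℝ}
    (hh : ContMDiff (𝓡 n) ((𝓡 n).prod 𝓘(ℝ, 𝔼 n →L[ℝ] 𝔼 n →L[ℝ] ℝ)) ∞
      (fun x => TotalSpace.mk' (𝔼 n →L[ℝ] 𝔼 n →L[ℝ] ℝ)
        (E := fun x : M => TangentSpace (𝓡 n) x →L[ℝ] TangentSpace (𝓡 n) x →L[ℝ] ℝ) x (h x)))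
    (hu : u ∈ (extChartAt (𝓡 n) c).target) (i j : Fin n) :
    ContDiffAt ℝ ∞ (fun u => formCoord h c u i j) u := by
  rw [← contMDiffAt_iff_contDiffAt]
  have h_apply : ContMDiffAt 𝓘(ℝ, 𝔼 n) ((𝓡 n).prod 𝓘(ℝ)) ∞
      (fun u => TotalSpace.mk' ℝ (E := Bundle.Trivial M ℝ) ((extChartAt (𝓡 n) c).symm u)
        (h ((extChartAt (𝓡 n) c).symm u) (coordLift c u (EuclideanSpace.single i 1))
          (coordLift c u (EuclideanSpace.single j 1)))) u :=
    ContMDiffAt.clm_bundle_apply₂ (F₁ := 𝔼 n) (F₂ := 𝔼 n)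
      (hh.contMDiffAt.comp u (contMDiffAt_extChartAt_symm hu))
      (contMDiffAt_coordLift hu _) (contMDiffAt_coordLift hu _)
  exact (contMDiffAt_totalSpace.1 h_apply).2

lemma contDiffAt_fieldCoord {ℓ : ∀ x : M, TangentSpace (𝓡 n) x}
    (hu : u ∈ (extChartAt (𝓡 n) c).target)
    (hℓ : ContMDiffAt (𝓡 n) (𝓡 n).tangent ∞ (fun x => (⟨x, ℓ x⟩ : TangentBundle (𝓡 n) M))
      ((extChartAt (𝓡 n) c).symm u)) :
    ContDiffAt ℝ ∞ (fieldCoord c ℓ) u := by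
  rw [← contMDiffAt_iff_contDiffAt]
  have h_open : IsOpen (chartAt (𝔼 n) c).source := (chartAt (𝔼 n) c).open_source
  have h_mem : ∀ w ∈ (extChartAt (𝓡 n) c).target,
      (extChartAt (𝓡 n) c).symm w ∈ (chartAt (𝔼 n) c).source := fun w hw => by
    rw [← extChartAt_source (I := 𝓡 n)]
    exact (extChartAt (𝓡 n) c).map_target hw
  have h_tangent := ((contMDiffOn_extChartAt (I := 𝓡 n) (n := ∞) (x := c)
    ).contMDiffOn_tangentMapWithin (m := ∞) (by simp) h_open.uniqueMDiffOn).contMDiffAt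
    (x := (⟨(extChartAt (𝓡 n) c).symm u, ℓ _⟩ : TangentBundle (𝓡 n) M))
    ((h_open.preimage (FiberBundle.continuous_proj _ _)).mem_nhds (h_mem u hu))
  have h_snd := (contMDiff_snd_tangentBundle_modelSpace (𝔼 n) (n := ∞)
    𝓘(ℝ, 𝔼 n)).contMDiffAt.comp u
    (h_tangent.comp u (hℓ.comp u (contMDiffAt_extChartAt_symm hu)))
  refine h_snd.congr_of_eventuallyEq ?_
  filter_upwards [(isOpen_extChartAt_target c).mem_nhds hu] with w hw
  change mfderiv _ _ _ _ _ = mfderivWithin _ _ _ _ _ _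
  rw [mfderivWithin_of_isOpen h_open (h_mem w hw)]
  rfl

end Charts

section Hypersurface

set_option maxSynthPendingDepth 3

open Filter Topology

variable {n d : ℕ} {M : Type*} [TopologicalSpace M] [ChartedSpace (𝔼 n) M]
  {S : Type*} [TopologicalSpace S] [ChartedSpace (𝔼 d) S]

variable (n d) in
/-- The map `ι` in the preferred charts around `p₀` and `c`. -/
noncomputable def chartMap (ι : S → M) (c : M) (p₀ : S) (u : 𝔼 d) : 𝔼 n :=
  extChartAt (𝓡 n) c (ι ((extChartAt (𝓡 d) p₀).symm u))

variable (n d) in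
/-- The coordinates at which the map `ι` can be written in the preferred charts around `p₀` and
`c`. -/
def chartDomain (ι : S → M) (c : M) (p₀ : S) : Set (𝔼 d) :=
  (extChartAt (𝓡 d) p₀).target ∩
    (extChartAt (𝓡 d) p₀).symm ⁻¹' (ι ⁻¹' (extChartAt (𝓡 n) c).source)

variable {ι : S → M} {c : M} {p₀ p : S} {u : 𝔼 d}

lemma isOpen_chartDomain (hι : Continuous ι) (c : M) (p₀ : S) : IsOpen (chartDomain n d ι c p₀) :=
  (continuousOn_extChartAt_symm p₀).isOpen_inter_preimage (isOpen_extChartAt_target p₀)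
    ((isOpen_extChartAt_source c).preimage hι)

lemma extChartAt_mem_chartDomain (hp : p ∈ (extChartAt (𝓡 d) p₀).source)
    (hc : ι p ∈ (extChartAt (𝓡 n) c).source) : extChartAt (𝓡 d) p₀ p ∈ chartDomain n d ι c p₀ := by
  refine ⟨(extChartAt (𝓡 d) p₀).map_source hp, ?_⟩
  rwa [mem_preimage, (extChartAt (𝓡 d) p₀).left_inv hp]

variable [IsManifold (𝓡 n) ∞ M]

lemma contMDiffAt_extChartAt_of_mem_chartDomain (hu : u ∈ chartDomain n d ι c p₀) :
    ContMDiffAt (𝓡 n) 𝓘(ℝ, 𝔼 n) ∞ (extChartAt (𝓡 n) c) (ι ((extChartAt (𝓡 d) p₀).symm u)) :=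
  contMDiffAt_extChartAt' (by rw [← extChartAt_source (I := 𝓡 n)]; exact hu.2)

variable [IsManifold (𝓡 d) ∞ S]

lemma contDiffAt_chartMap (hι : ContMDiff (𝓡 d) (𝓡 n) ∞ ι) (hu : u ∈ chartDomain n d ι c p₀) :
    ContDiffAt ℝ ∞ (chartMap n d ι c p₀) u :=
  ((contMDiffAt_extChartAt_of_mem_chartDomain hu).comp u
    (hι.contMDiffAt.comp u (contMDiffAt_extChartAt_symm hu.1))).contDiffAt

lemma fderiv_chartMap (hι : ContMDiff (𝓡 d) (𝓡 n) ∞ ι) (hu : u ∈ chartDomain n d ι c p₀) (X : 𝔼 d) :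
    fderiv ℝ (chartMap n d ι c p₀) u X = vecCoord c (ι ((extChartAt (𝓡 d) p₀).symm u))
      (mfderiv (𝓡 d) (𝓡 n) ι ((extChartAt (𝓡 d) p₀).symm u) (coordLift p₀ u X)) := by
  have h_symm := ((contMDiffAt_extChartAt_symm hu.1).mdifferentiableAt (by simp)).hasMFDerivAt
  have h_map := (hι.contMDiffAt.mdifferentiableAt (by simp)).hasMFDerivAt
    (x := (extChartAt (𝓡 d) p₀).symm u)
  have h_chart :=
    ((contMDiffAt_extChartAt_of_mem_chartDomain hu).mdifferentiableAt (by simp)).hasMFDerivAt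
  exact DFunLike.congr_fun
    (mfderiv_eq_fderiv.symm.trans (h_chart.comp u (h_map.comp u h_symm)).mfderiv) X

lemma fderiv_chartMap_vecCoord (hι : ContMDiff (𝓡 d) (𝓡 n) ∞ ι)
    (hp : p ∈ (extChartAt (𝓡 d) p₀).source) (hc : ι p ∈ (extChartAt (𝓡 n) c).source)
    (X : TangentSpace (𝓡 d) p) :
    fderiv ℝ (chartMap n d ι c p₀) (extChartAt (𝓡 d) p₀ p) (vecCoord p₀ p X)
      = vecCoord c (ι p) (mfderiv (𝓡 d) (𝓡 n) ι p X) := by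
  obtain ⟨u, hu, rfl⟩ := (extChartAt (𝓡 d) p₀).symm.surjOn hp
  rw [(extChartAt (𝓡 d) p₀).right_inv hu, fderiv_chartMap hι ⟨hu, hc⟩, coordLift_vecCoord hu]

lemma injective_fderiv_chartMap (hι : ContMDiff (𝓡 d) (𝓡 n) ∞ ι)
    (hinj : ∀ p, Function.Injective (mfderiv (𝓡 d) (𝓡 n) ι p)) (hu : u ∈ chartDomain n d ι c p₀) :
    Function.Injective (fderiv ℝ (chartMap n d ι c p₀) u) := by
  intro X Y hXY
  rw [fderiv_chartMap hι hu, fderiv_chartMap hι hu] at hXY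
  have h_lift := hinj _ ((vecCoordEquiv hu.2).injective hXY)
  rw [← vecCoord_coordLift hu.1 X, h_lift, vecCoord_coordLift hu.1]

namespace LorentzMetric

variable (g : LorentzMetric n M)

lemma isLorentzian (x : M) : IsLorentzian (g.val x).toBilinForm :=
  ⟨⟨g.symm x⟩, g.lorentzian x⟩

/-- The metric in the preferred chart around `c`. -/
noncomputable def metricCoord (c : M) : 𝔼 n → 𝔼 n →L[ℝ] 𝔼 n →L[ℝ] ℝ :=
  matrixForm (formCoord g.val c)

/-- The Levi-Civita connection in the preferred chart around `c`. -/
noncomputable def connectionCoord (c : M) : 𝔼 n → 𝔼 n →L[ℝ] 𝔼 n →L[ℝ] 𝔼 n :=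
  christoffelForm (formCoord g.val c)

lemma formCoord_isSymm (c : M) (x : 𝔼 n) : (formCoord g.val c x).IsSymm :=
  Matrix.IsSymm.ext fun _ _ => g.symm _ _ _

lemma isLorentzian_metricCoord {x : 𝔼 n} (hx : x ∈ (extChartAt (𝓡 n) c).target) :
    IsLorentzian (g.metricCoord c x).toBilinForm := by
  have h_apply (v w : 𝔼 n) : (g.metricCoord c x).toBilinForm v w
      = g.val _ (coordLift c x v) (coordLift c x w) := matrixForm_formCoord _ _ _ _ _
  obtain ⟨t, ht, ht_pos⟩ := g.lorentzian ((extChartAt (𝓡 n) c).symm x)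
  refine ⟨⟨fun v w => by simp only [h_apply]; exact g.symm _ _ _⟩,
    vecCoord c _ t, ?_, fun v hv hv0 => ?_⟩
  · rwa [h_apply, coordLift_vecCoord hx]
  · rw [h_apply, coordLift_vecCoord hx] at hv
    rw [h_apply]
    refine ht_pos _ hv fun h0 => hv0 ?_
    rw [← vecCoord_coordLift hx v, h0]
    exact map_zero (vecCoordEquiv ((extChartAt (𝓡 n) c).map_target hx))

lemma det_formCoord_ne_zero {x : 𝔼 n} (hx : x ∈ (extChartAt (𝓡 n) c).target) :
    (formCoord g.val c x).det ≠ 0 := by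
  have h := (LinearMap.separatingLeft_iff_det_ne_zero
    (EuclideanSpace.basisFun (Fin n) ℝ).toBasis).1 (g.isLorentzian_metricCoord hx).separatingLeft
  convert h using 2
  ext i j
  simp [metricCoord, matrixForm_single]

lemma isLorentzImmersionAt_chartMap (hι : ContMDiff (𝓡 d) (𝓡 n) ∞ ι)
    (hinj : ∀ p, Function.Injective (mfderiv (𝓡 d) (𝓡 n) ι p)) (hu : u ∈ chartDomain n d ι c p₀) :
    IsLorentzImmersionAt (g.connectionCoord c) (g.metricCoord c) (chartMap n d ι c p₀) u := by
  have hx : chartMap n d ι c p₀ u ∈ (extChartAt (𝓡 n) c).target :=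
    (extChartAt (𝓡 n) c).map_source hu.2
  have h_nhds := (isOpen_extChartAt_target (I := 𝓡 n) c).mem_nhds hx
  have hG (y : 𝔼 n) (hy : y ∈ (extChartAt (𝓡 n) c).target) (i j : Fin n) :
      ContDiffAt ℝ 2 (fun y => formCoord g.val c y i j) y :=
    (contDiffAt_formCoord g.contMDiff hy i j).of_le ENat.LEInfty.out
  have hGs (x : 𝔼 n) : ∀ᶠ y in 𝓝 x, (formCoord g.val c y).IsSymm :=
    .of_forall (g.formCoord_isSymm c)
  exact
    { contDiffAt := (contDiffAt_chartMap hι hu).of_le ENat.LEInfty.out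
      contDiffAt_metric := contDiffAt_matrixForm (hG _ hx)
      contDiffAt_christoffel := contDiffAt_christoffelForm (hG _ hx) (by norm_num)
        (g.det_formCoord_ne_zero hx)
      torsion_free := .of_forall fun y => christoffelForm_comm (hGs y)
      parallel := by
        filter_upwards [h_nhds] with y hy
        exact isParallelAt_christoffelForm
          ((contDiffAt_matrixForm (hG y hy)).differentiableAt (by simp)) (hGs y)
          (g.det_formCoord_ne_zero hy)
      lorentz := by
        filter_upwards [h_nhds] with y hy using g.isLorentzian_metricCoord hy
      injective := injective_fderiv_chartMap hι hinj hu }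

lemma metricCoord_chartMap_vecCoord (hι : ContMDiff (𝓡 d) (𝓡 n) ∞ ι)
    (hp : p ∈ (extChartAt (𝓡 d) p₀).source) (hc : ι p ∈ (extChartAt (𝓡 n) c).source)
    (X Y : TangentSpace (𝓡 d) p) :
    g.metricCoord c (chartMap n d ι c p₀ (extChartAt (𝓡 d) p₀ p))
      (fderiv ℝ (chartMap n d ι c p₀) (extChartAt (𝓡 d) p₀ p) (vecCoord p₀ p X))
      (fderiv ℝ (chartMap n d ι c p₀) (extChartAt (𝓡 d) p₀ p) (vecCoord p₀ p Y))
      = g.induced ι p X Y := by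
  rw [fderiv_chartMap_vecCoord hι hp hc, fderiv_chartMap_vecCoord hι hp hc, induced_apply,
    chartMap, (extChartAt (𝓡 d) p₀).left_inv hp]
  exact matrixForm_formCoord_vecCoord g.val hc _ _

lemma metricCoord_chartMap (hι : ContMDiff (𝓡 d) (𝓡 n) ∞ ι) (hu : u ∈ chartDomain n d ι c p₀)
    (X Y : 𝔼 d) :
    g.metricCoord c (chartMap n d ι c p₀ u) (fderiv ℝ (chartMap n d ι c p₀) u X)
      (fderiv ℝ (chartMap n d ι c p₀) u Y) = matrixForm (formCoord (g.induced ι) p₀) u X Y := by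
  have h := g.metricCoord_chartMap_vecCoord (c := c) hι ((extChartAt (𝓡 d) p₀).map_target hu.1) hu.2
    (coordLift p₀ u X) (coordLift p₀ u Y)
  rw [(extChartAt (𝓡 d) p₀).right_inv hu.1, vecCoord_coordLift hu.1,
    vecCoord_coordLift hu.1] at h
  rw [h, matrixForm_formCoord]

end LorentzMetric

end Hypersurface

section NullSurface

set_option maxSynthPendingDepth 3

open Filter Topology

lemma fderiv_eq_sum_mul_partialDeriv {d : ℕ} {f : 𝔼 d → ℝ} (u v : 𝔼 d) :
    fderiv ℝ f u v = ∑ c, v c * partialDeriv c f u := by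
  conv_lhs => rw [← sum_smul_single v, map_sum]
  simp only [map_smul, smul_eq_mul, partialDeriv]

lemma fderiv_single_apply {d m : ℕ} {L : 𝔼 d → 𝔼 m} {u : 𝔼 d} (hL : DifferentiableAt ℝ L u)
    (a : Fin d) (c : Fin m) :
    fderiv ℝ L u (EuclideanSpace.single a 1) c = partialDeriv a (fun w => L w c) u := by
  have h := (EuclideanSpace.proj c : 𝔼 m →L[ℝ] ℝ).hasFDerivAt.comp u hL.hasFDerivAt
  exact (DFunLike.congr_fun h.fderiv (EuclideanSpace.single a 1)).symm

lemma sum_lieDerivative_eq {d : ℕ} {H : 𝔼 d → Matrix (Fin d) (Fin d) ℝ} {L : 𝔼 d → 𝔼 d} {u : 𝔼 d}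
    (hH : DifferentiableAt ℝ (matrixForm H) u) (hL : DifferentiableAt ℝ L u) (X Y : 𝔼 d) :
    ∑ a, ∑ b, (∑ c, (L u c * partialDeriv c (fun w => H w a b) u
      + H u c b * partialDeriv a (fun w => L w c) u
      + H u a c * partialDeriv b (fun w => L w c) u)) * X a * Y b
      = fderiv ℝ (fun w => matrixForm H w X Y) u (L u) + matrixForm H u (fderiv ℝ L u X) Y
        + matrixForm H u X (fderiv ℝ L u Y) := by
  let K : Matrix (Fin d) (Fin d) ℝ := Matrix.of fun a b =>
    ∑ c, (L u c * partialDeriv c (fun w => H w a b) u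
      + H u c b * partialDeriv a (fun w => L w c) u
      + H u a c * partialDeriv b (fun w => L w c) u)
  rw [fderiv_clm_apply_const (hH.clm_apply (differentiableAt_const X)), fderiv_clm_apply_const hH]
  refine (matrixForm_apply (fun _ => K) u X Y).symm.trans ?_
  induction X using induction_single with
  | hzero => simp only [map_zero, _root_.zero_apply, add_zero]
  | hadd r v w hv hw =>
    simp only [map_add, map_smul, _root_.add_apply, _root_.smul_apply, smul_eq_mul, hv, hw]
    ring
  | hsingle a =>
  induction Y using induction_single with
  | hzero => simp only [map_zero, add_zero]
  | hadd r v w hv hw =>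
    simp only [map_add, map_smul, smul_eq_mul, hv, hw]
    ring
  | hsingle b =>
  rw [matrixForm_single, ← fderiv_clm_apply_const hH,
    ← fderiv_clm_apply_const (hH.clm_apply (differentiableAt_const _))]
  simp only [matrixForm_single, fderiv_eq_sum_mul_partialDeriv]
  simp only [matrixForm_apply, fderiv_single_apply hL, PiLp.single_apply, mul_ite, ite_mul, mul_one,
    mul_zero, zero_mul, Finset.sum_ite_eq', Finset.sum_ite_irrel, Finset.sum_const_zero,
    Finset.mem_univ, if_true, K, Matrix.of_apply, Finset.sum_add_distrib]

variable {n d : ℕ} {M : Type*} [TopologicalSpace M] [ChartedSpace (𝔼 n) M]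
  [IsManifold (𝓡 n) ∞ M] {S : Type*} [TopologicalSpace S] [ChartedSpace (𝔼 d) S]

namespace LorentzMetric

section Algebra

variable {g : LorentzMetric n M} {ι : S → M} {p : S} {v w : TangentSpace (𝓡 d) p}

lemma IsNullSurface.induced_eq_zero (hS : g.IsNullSurface (d := d) ι)
    (hv : g.induced ι p v v = 0) (w : TangentSpace (𝓡 d) p) : g.induced ι p v w = 0 := by
  obtain ⟨k, hk, hkd⟩ := hS.degenerate p
  have hk0 : mfderiv (𝓡 d) (𝓡 n) ι p k ≠ 0 :=
    (map_ne_zero_iff _ (hS.injective_mfderiv p)).2 hk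
  obtain ⟨r, hr⟩ | h_pos := (g.isLorentzian (ι p)).exists_eq_smul_or_pos hk0 (hkd k) (hkd v)
  · obtain rfl : v = r • k := hS.injective_mfderiv p (hr.trans (map_smul _ r k).symm)
    rw [map_smul, _root_.smul_apply, hkd, smul_zero]
  · exact absurd hv h_pos.ne'

lemma IsNullSurface.nullDirection_eq_span (hS : g.IsNullSurface (d := d) ι) (hv0 : v ≠ 0)
    (hv : g.induced ι p v v = 0) :
    g.nullDirection (d := d) ι p = Submodule.span ℝ {v} := by
  rw [← (g.isLorentzian (ι p)).ker_comp_eq_span (A := (mfderiv (𝓡 d) (𝓡 n) ι p).toLinearMap)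
    (hS.injective_mfderiv p) hv0 (hS.induced_eq_zero hv)]
  ext x
  simp only [nullDirection, LinearMap.mem_ker, LinearMap.ext_iff, ContinuousLinearMap.ext_iff]
  rfl

lemma IsNullSurface.exists_smul (hS : g.IsNullSurface (d := d) ι) (hv0 : v ≠ 0)
    (hv : g.induced ι p v v = 0) (hw : g.induced ι p w w = 0) : ∃ r : ℝ, w = r • v := by
  have hw' : w ∈ g.nullDirection (d := d) ι p :=
    ContinuousLinearMap.ext (hS.induced_eq_zero hw)
  rw [hS.nullDirection_eq_span hv0 hv, Submodule.mem_span_singleton] at hw'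
  exact hw'.imp fun _ => Eq.symm

lemma IsNullSurface.eventually_mem_chartDomain {c : M} {p₀ : S} {u : 𝔼 d}
    (hS : g.IsNullSurface (d := d) ι) (hu : u ∈ chartDomain n d ι c p₀) :
    ∀ᶠ v in 𝓝 u, v ∈ chartDomain n d ι c p₀ :=
  (isOpen_chartDomain hS.contMDiff.continuous c p₀).mem_nhds hu

end Algebra

variable [IsManifold (𝓡 d) ∞ S]

lemma IsNullField.eventually_mem {g : LorentzMetric n M} {ι : S → M} {p₀ p : S} {U : Set S}
    {ℓ : ∀ p : S, TangentSpace (𝓡 d) p} (hℓ : g.IsNullField ι U ℓ) (hpU : p ∈ U)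
    (hp : p ∈ (extChartAt (𝓡 d) p₀).source) :
    ∀ᶠ v in 𝓝 (extChartAt (𝓡 d) p₀ p), (extChartAt (𝓡 d) p₀).symm v ∈ U := by
  refine (contMDiffAt_extChartAt_symm ((extChartAt (𝓡 d) p₀).map_source hp)).continuousAt.eventually
    (hℓ.isOpen.mem_nhds ?_)
  rwa [(extChartAt (𝓡 d) p₀).left_inv hp]

/-- The map `X ↦ ∇_X ℓ`, for a vector field `ℓ` on `S`, in the preferred charts around `p₀` and
`c`. -/
noncomputable def fieldDerivCoord (g : LorentzMetric n M) (ι : S → M) (c : M) (p₀ : S)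
    (ℓ : ∀ p : S, TangentSpace (𝓡 d) p) (u : 𝔼 d) : 𝔼 d →L[ℝ] 𝔼 n :=
  covAlong (g.connectionCoord c) (chartMap n d ι c p₀)
    (fun w => fderiv ℝ (chartMap n d ι c p₀) w (fieldCoord p₀ ℓ w)) u

namespace IsNullSurface

variable {g : LorentzMetric n M} {ι : S → M} {c : M} {p₀ p : S} {u : 𝔼 d} {U : Set S}
  {ℓ : ∀ p : S, TangentSpace (𝓡 d) p}

lemma isLorentzImmersionAt (hS : g.IsNullSurface (d := d) ι) (hu : u ∈ chartDomain n d ι c p₀) :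
    IsLorentzImmersionAt (g.connectionCoord c) (g.metricCoord c) (chartMap n d ι c p₀) u :=
  g.isLorentzImmersionAt_chartMap hS.contMDiff hS.injective_mfderiv hu

lemma isDegenerateFieldAt (hS : g.IsNullSurface (d := d) ι) (hℓ : g.IsNullField ι U ℓ) (hpU : p ∈ U)
    (hp : p ∈ (extChartAt (𝓡 d) p₀).source) (hc : ι p ∈ (extChartAt (𝓡 n) c).source) :
    IsDegenerateFieldAt (g.metricCoord c) (chartMap n d ι c p₀) (fieldCoord p₀ ℓ)
      (extChartAt (𝓡 d) p₀ p) where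
  contDiffAt := by
    have h_smooth := hℓ.contMDiffOn.contMDiffAt (hℓ.isOpen.mem_nhds
      (hℓ.eventually_mem hpU hp).self_of_nhds)
    exact (contDiffAt_fieldCoord ((extChartAt (𝓡 d) p₀).map_source hp) h_smooth).of_le
      ENat.LEInfty.out
  orthogonal := by
    filter_upwards [hℓ.eventually_mem hpU hp,
      hS.eventually_mem_chartDomain (extChartAt_mem_chartDomain hp hc)] with v hvU hv Y
    rw [g.metricCoord_chartMap hS.contMDiff hv, matrixForm_formCoord, fieldCoord,
      coordLift_vecCoord hv.1]
    exact hS.induced_eq_zero (hℓ.null _ hvU) _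

lemma differentiableAt_matrixForm_induced (hS : g.IsNullSurface (d := d) ι)
    (hu : u ∈ chartDomain n d ι c p₀) :
    DifferentiableAt ℝ (matrixForm (formCoord (g.induced ι) p₀)) u := by
  have h := hS.isLorentzImmersionAt hu
  refine (contDiffAt_matrixForm (m := 1) fun i j => ?_).differentiableAt (by simp)
  have h_metric := ((h.contDiffAt_metric.comp u (h.contDiffAt.of_le (by norm_num))).clm_apply
    (h.contDiffAt_fderiv_apply (contDiffAt_const (c := EuclideanSpace.single i 1)))).clm_apply
    (h.contDiffAt_fderiv_apply (contDiffAt_const (c := EuclideanSpace.single j 1)))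
  refine (h_metric.of_le (by norm_num)).congr_of_eventuallyEq ?_
  filter_upwards [hS.eventually_mem_chartDomain hu] with v hv
  exact (matrixForm_single _ v i j).symm.trans (g.metricCoord_chartMap hS.contMDiff hv _ _).symm

lemma lieDerivative_eq_two_mul (hS : g.IsNullSurface (d := d) ι) (hℓ : g.IsNullField ι U ℓ)
    (hpU : p ∈ U) (hp : p ∈ (extChartAt (𝓡 d) p₀).source)
    (hc : ι p ∈ (extChartAt (𝓡 n) c).source) (X Y : 𝔼 d) :
    let u := extChartAt (𝓡 d) p₀ p
    let H := matrixForm (formCoord (g.induced ι) p₀)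
    let L := fieldCoord p₀ ℓ
    fderiv ℝ (fun w => H w X Y) u (L u) + H u (fderiv ℝ L u X) Y + H u X (fderiv ℝ L u Y)
      = 2 * g.metricCoord c (chartMap n d ι c p₀ u) (g.fieldDerivCoord ι c p₀ ℓ u X)
        (fderiv ℝ (chartMap n d ι c p₀) u Y) := by
  intro u H L
  have hu : u ∈ chartDomain n d ι c p₀ := extChartAt_mem_chartDomain hp hc
  have h_induced : (fun w => g.metricCoord c (chartMap n d ι c p₀ w)
      (fderiv ℝ (chartMap n d ι c p₀) w X) (fderiv ℝ (chartMap n d ι c p₀) w Y))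
      =ᶠ[𝓝 u] fun w => H w X Y := by
    filter_upwards [hS.eventually_mem_chartDomain hu] with v hv
    exact g.metricCoord_chartMap hS.contMDiff hv X Y
  rw [fieldDerivCoord, ← (hS.isDegenerateFieldAt hℓ hpU hp hc).lieDerivative
    (hS.isLorentzImmersionAt hu), h_induced.fderiv_eq, g.metricCoord_chartMap hS.contMDiff hu,
    g.metricCoord_chartMap hS.contMDiff hu]

end IsNullSurface

section CovDerivAlong

variable {ι : S → M} {c : M} {p₀ p : S} {ℓ : ∀ p : S, TangentSpace (𝓡 d) p}

lemma mfderiv_vecCoord_mfderiv (hι : ContMDiff (𝓡 d) (𝓡 n) ∞ ι)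
    (hp : p ∈ (extChartAt (𝓡 d) p₀).source) (hc : ι p ∈ (extChartAt (𝓡 n) c).source)
    (hℓ : DifferentiableAt ℝ (fun u => fderiv ℝ (chartMap n d ι c p₀) u (fieldCoord p₀ ℓ u))
      (extChartAt (𝓡 d) p₀ p)) (X : TangentSpace (𝓡 d) p) :
    (mfderiv (𝓡 d) 𝓘(ℝ, 𝔼 n)
        (fun q => vecCoord c (ι q) (mfderiv (𝓡 d) (𝓡 n) ι q (ℓ q))) p X : 𝔼 n)
      = fderiv ℝ (fun u => fderiv ℝ (chartMap n d ι c p₀) u (fieldCoord p₀ ℓ u))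
        (extChartAt (𝓡 d) p₀ p) (vecCoord p₀ p X) := by
  have h_eq : (fun q => vecCoord c (ι q) (mfderiv (𝓡 d) (𝓡 n) ι q (ℓ q))) =ᶠ[𝓝 p]
      (fun u => fderiv ℝ (chartMap n d ι c p₀) u (fieldCoord p₀ ℓ u)) ∘ extChartAt (𝓡 d) p₀ := by
    filter_upwards [(isOpen_extChartAt_source (I := 𝓡 d) p₀).mem_nhds hp,
      ((isOpen_extChartAt_source (I := 𝓡 n) c).preimage hι.continuous).mem_nhds hc] with q hq hqc
    rw [Function.comp_apply, fieldCoord_extChartAt hq, fderiv_chartMap_vecCoord hι hq hqc]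
  have h_chart : MDifferentiableAt (𝓡 d) 𝓘(ℝ, 𝔼 d) (extChartAt (𝓡 d) p₀) p :=
    mdifferentiableAt_extChartAt (by rwa [← extChartAt_source (I := 𝓡 d)])
  have h_comp := (hℓ.hasFDerivAt.hasMFDerivAt.comp p h_chart.hasMFDerivAt
    ).congr_of_eventuallyEq h_eq
  exact DFunLike.congr_fun h_comp.mfderiv X

lemma vecCoord_covDerivAlong (g : LorentzMetric n M) (hι : ContMDiff (𝓡 d) (𝓡 n) ∞ ι)
    (hp : p ∈ (extChartAt (𝓡 d) p₀).source)
    (hℓ : DifferentiableAt ℝ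
      (fun u => fderiv ℝ (chartMap n d ι (ι p) p₀) u (fieldCoord p₀ ℓ u))
      (extChartAt (𝓡 d) p₀ p)) (X : TangentSpace (𝓡 d) p) :
    vecCoord (ι p) (ι p) (g.covDerivAlong ι (fun q => mfderiv (𝓡 d) (𝓡 n) ι q (ℓ q)) p X)
      = g.fieldDerivCoord ι (ι p) p₀ ℓ (extChartAt (𝓡 d) p₀ p) (vecCoord p₀ p X) := by
  have hc : ι p ∈ (extChartAt (𝓡 n) (ι p)).source := mem_extChartAt_source _
  have h_inverse (D : 𝔼 n) : vecCoord (ι p) (ι p)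
      ((mfderiv (𝓡 n) 𝓘(ℝ, 𝔼 n) (extChartAt (𝓡 n) (ι p)) (ι p)).inverse D) = D :=
    DFunLike.congr_fun (isInvertible_mfderiv_extChartAt (I := 𝓡 n) hc).self_comp_inverse D
  refine (h_inverse _).trans ?_
  ext k
  rw [fieldDerivCoord, covAlong_apply, PiLp.add_apply, connectionCoord, christoffelForm_apply,
    fieldCoord_extChartAt hp, fderiv_chartMap_vecCoord hι hp hc, fderiv_chartMap_vecCoord hι hp hc,
    ← mfderiv_vecCoord_mfderiv hι hp hc hℓ, chartMap, (extChartAt (𝓡 d) p₀).left_inv hp]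

end CovDerivAlong

namespace IsNullSurface

variable {g : LorentzMetric n M} {ι : S → M} {c : M} {p₀ p : S} {U U' : Set S}
  {ℓ ℓ' : ∀ p : S, TangentSpace (𝓡 d) p}

-- Half the Lie derivative of `q` does not involve the chart of `M`, so the formula for the chart
-- around `ι p`, in which `derivTensor` is defined, carries over to any other chart.
lemma derivTensor_eq (hS : g.IsNullSurface (d := d) ι) (hℓ : g.IsNullField ι U ℓ) (hpU : p ∈ U)
    (hp : p ∈ (extChartAt (𝓡 d) p₀).source) (hc : ι p ∈ (extChartAt (𝓡 n) c).source)
    (X Y : TangentSpace (𝓡 d) p) :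
    let u := extChartAt (𝓡 d) p₀ p
    g.derivTensor ι ℓ p X Y = g.metricCoord c (chartMap n d ι c p₀ u)
      (g.fieldDerivCoord ι c p₀ ℓ u (vecCoord p₀ p X))
      (fderiv ℝ (chartMap n d ι c p₀) u (vecCoord p₀ p Y)) := by
  intro u
  have hc' : ι p ∈ (extChartAt (𝓡 n) (ι p)).source := mem_extChartAt_source _
  have h_diff := ((hS.isLorentzImmersionAt (extChartAt_mem_chartDomain hp hc')
    ).contDiffAt_fderiv_apply (hS.isDegenerateFieldAt hℓ hpU hp hc').contDiffAt).differentiableAt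
    (by simp)
  have h_self : g.derivTensor ι ℓ p X Y = g.metricCoord (ι p) (chartMap n d ι (ι p) p₀ u)
      (g.fieldDerivCoord ι (ι p) p₀ ℓ u (vecCoord p₀ p X))
      (fderiv ℝ (chartMap n d ι (ι p) p₀) u (vecCoord p₀ p Y)) := by
    rw [derivTensor, ← matrixForm_formCoord_vecCoord g.val hc',
      g.vecCoord_covDerivAlong hS.contMDiff hp h_diff,
      ← fderiv_chartMap_vecCoord hS.contMDiff hp hc', chartMap, (extChartAt (𝓡 d) p₀).left_inv hp]
    rfl
  have h_lie := hS.lieDerivative_eq_two_mul hℓ hpU hp hc (vecCoord p₀ p X) (vecCoord p₀ p Y)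
  have h_lie' := hS.lieDerivative_eq_two_mul hℓ hpU hp hc' (vecCoord p₀ p X) (vecCoord p₀ p Y)
  linarith

lemma derivTensor_eq_mul (hS : g.IsNullSurface (d := d) ι) (hℓ : g.IsNullField ι U ℓ)
    (hℓ' : g.IsNullField ι U' ℓ') (hpU : p ∈ U) (hpU' : p ∈ U') {r : ℝ} (hr : ℓ' p = r • ℓ p)
    (X Y : TangentSpace (𝓡 d) p) :
    g.derivTensor ι ℓ' p X Y = r * g.derivTensor ι ℓ p X Y := by
  have hp : p ∈ (extChartAt (𝓡 d) p).source := mem_extChartAt_source _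
  have hc : ι p ∈ (extChartAt (𝓡 n) (ι p)).source := mem_extChartAt_source _
  have h := hS.isLorentzImmersionAt (extChartAt_mem_chartDomain hp hc)
  rw [hS.derivTensor_eq hℓ hpU hp hc, hS.derivTensor_eq hℓ' hpU' hp hc, fieldDerivCoord,
    fieldDerivCoord, (hS.isDegenerateFieldAt hℓ hpU hp hc).metric_covAlong h,
    (hS.isDegenerateFieldAt hℓ' hpU' hp hc).metric_covAlong h, fieldCoord_extChartAt hp,
    fieldCoord_extChartAt hp, hr, vecCoord_smul, map_smul, map_smul, _root_.smul_apply,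
    smul_eq_mul, mul_neg]

lemma lieDerivForm_eq_two_mul (hS : g.IsNullSurface (d := d) ι) (hℓ : g.IsNullField ι U ℓ)
    (hpU : p ∈ U) (X Y : TangentSpace (𝓡 d) p) :
    lieDerivForm (g.induced ι) ℓ p X Y = 2 * g.derivTensor ι ℓ p X Y := by
  have hp : p ∈ (extChartAt (𝓡 d) p).source := mem_extChartAt_source _
  have hc : ι p ∈ (extChartAt (𝓡 n) (ι p)).source := mem_extChartAt_source _
  rw [hS.derivTensor_eq hℓ hpU hp hc, ← hS.lieDerivative_eq_two_mul hℓ hpU hp hc]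
  exact sum_lieDerivative_eq
    (hS.differentiableAt_matrixForm_induced (extChartAt_mem_chartDomain hp hc))
    ((hS.isDegenerateFieldAt hℓ hpU hp hc).contDiffAt.differentiableAt (by simp)) _ _

end IsNullSurface

end LorentzMetric

end NullSurface

section NonExpanding

set_option maxSynthPendingDepth 3

open Filter Topology

variable {n d : ℕ} {M : Type*} [TopologicalSpace M] [ChartedSpace (𝔼 n) M]
  [IsManifold (𝓡 n) ∞ M] {S : Type*} [TopologicalSpace S] [ChartedSpace (𝔼 d) S]

namespace LorentzMetric

section Ricci

variable (g : LorentzMetric n M) (x : M)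

lemma ricci_smul_self (r : ℝ) (v : TangentSpace (𝓡 n) x) :
    g.ricci x (r • v) (r • v) = r ^ 2 * g.ricci x v v := by
  simp only [ricci, vecCoord_smul, PiLp.smul_apply, smul_eq_mul, Finset.mul_sum]
  exact Finset.sum_congr rfl fun _ _ => Finset.sum_congr rfl fun _ _ => by ring

lemma ricci_self_eq_trace_jacobiOperator (v : TangentSpace (𝓡 n) x) :
    g.ricci x v v = LinearMap.trace ℝ (𝔼 n)
      (jacobiOperator (g.connectionCoord x) (extChartAt (𝓡 n) x x) (vecCoord x x v)) := by
  have hx := mem_extChartAt_target (I := 𝓡 n) x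
  have h_smooth : ContDiffAt ℝ 1 (g.connectionCoord x) (extChartAt (𝓡 n) x x) :=
    contDiffAt_christoffelForm
      (fun i j => (contDiffAt_formCoord g.contMDiff hx i j).of_le (m := 2) ENat.LEInfty.out)
      (by norm_num) (g.det_formCoord_ne_zero hx)
  exact sum_ricciCoord_eq_trace_jacobiOperator (h_smooth.differentiableAt (by simp)) _

lemma ricci_self_eq_of_einstein_eq {Λ t : ℝ} {v : TangentSpace (𝓡 n) x} (hv : g.val x v v = 0)
    (h_einstein : g.einstein x v v = -Λ * g.val x v v + t) : g.ricci x v v = t := by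
  rw [einstein, hv] at h_einstein
  linarith

end Ricci

namespace IsNullSurface

variable {g : LorentzMetric n M} {ι : S → M} {p : S} {ℓ : ∀ p : S, TangentSpace (𝓡 d) p}

lemma expansion_eq_trace_sub (hS : g.IsNullSurface (d := d) ι) (h0 : ℓ p ≠ 0)
    (hnull : g.induced ι p (ℓ p) (ℓ p) = 0)
    {W : TangentSpace (𝓡 d) p →ₗ[ℝ] TangentSpace (𝓡 d) p}
    (hW : ∀ X Y, g.derivTensor ι ℓ p X Y = g.induced ι p (W X) Y) {κ : ℝ}
    (hκ : W (ℓ p) = κ • ℓ p) :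
    g.expansion ι ℓ p = LinearMap.trace ℝ _ W - κ := by
  have : FiniteDimensional ℝ (TangentSpace (𝓡 d) p) :=
    inferInstanceAs (FiniteDimensional ℝ (𝔼 d))
  have h_span : g.nullDirection (d := d) ι p = Submodule.span ℝ {ℓ p} :=
    hS.nullDirection_eq_span h0 hnull
  have h_smul : ∀ x ∈ g.nullDirection (d := d) ι p, W x = κ • x := fun x hx => by
    obtain ⟨r, rfl⟩ := Submodule.mem_span_singleton.1 (h_span ▸ hx)
    rw [map_smul, hκ, smul_comm]
  have h_comap : g.nullDirection (d := d) ι p ≤ (g.nullDirection (d := d) ι p).comap W :=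
    fun x hx => by
      rw [Submodule.mem_comap, h_smul x hx]
      exact Submodule.smul_mem _ _ hx
  have h_ker : LinearMap.ker (g.induced ι p).toBilinForm = g.nullDirection (d := d) ι p := by
    ext x
    simp only [nullDirection, LinearMap.mem_ker, LinearMap.ext_iff, ContinuousLinearMap.ext_iff]
    rfl
  rw [trace_eq_add_trace_mapQ_of_finrank_eq_one (h_span ▸ finrank_span_singleton h0) h_smul h_comap,
    add_sub_cancel_left, ← sum_inv_gram_mul_eq_trace_mapQ ⟨fun x y => g.symm _ _ _⟩ h_ker h_comap
      (finBasis ℝ (TangentSpace (𝓡 d) p ⧸ g.nullDirection (d := d) ι p))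
      (e := g.screenBasis (d := d) ι p) (fun A => Quotient.out_eq _)]
  simp only [expansion, hW]
  rfl

variable [IsManifold (𝓡 d) ∞ S] {c : M} {p₀ : S} {U : Set S}

lemma expansion_eq_trace_sub_of_fieldDerivCoord_eq (hS : g.IsNullSurface (d := d) ι)
    (hℓ : g.IsNullField ι U ℓ) (hpU : p ∈ U) (h0 : ℓ p ≠ 0)
    (hp : p ∈ (extChartAt (𝓡 d) p₀).source) (hc : ι p ∈ (extChartAt (𝓡 n) c).source)
    {W : 𝔼 d →L[ℝ] 𝔼 d} {κ : ℝ}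
    (hW : g.fieldDerivCoord ι c p₀ ℓ (extChartAt (𝓡 d) p₀ p)
      = fderiv ℝ (chartMap n d ι c p₀) (extChartAt (𝓡 d) p₀ p) ∘L W)
    (hκ : W (vecCoord p₀ p (ℓ p)) = κ • vecCoord p₀ p (ℓ p)) :
    g.expansion ι ℓ p = LinearMap.trace ℝ (𝔼 d) W - κ := by
  let A := vecCoordEquiv hp
  have h_vecCoord (X : TangentSpace (𝓡 d) p) :
      vecCoord p₀ p (A.symm.conj (W : 𝔼 d →ₗ[ℝ] 𝔼 d) X) = W (vecCoord p₀ p X) :=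
    A.apply_symm_apply _
  have h_deriv (X Y : TangentSpace (𝓡 d) p) :
      g.derivTensor ι ℓ p X Y = g.induced ι p (A.symm.conj (W : 𝔼 d →ₗ[ℝ] 𝔼 d) X) Y := by
    rw [hS.derivTensor_eq hℓ hpU hp hc, hW, ← g.metricCoord_chartMap_vecCoord hS.contMDiff hp hc,
      h_vecCoord]
    rfl
  have h_field : A.symm.conj (W : 𝔼 d →ₗ[ℝ] 𝔼 d) (ℓ p) = κ • ℓ p := by
    apply A.injective
    rw [map_smul]
    exact (h_vecCoord _).trans hκ
  rw [hS.expansion_eq_trace_sub h0 (hℓ.null p hpU) h_deriv h_field, LinearMap.trace_conj']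

lemma expansion_eq_zero (hS : g.IsNullSurface (d := d) ι) (hexp : g.IsNonExpanding (d := d) ι)
    (hℓ : g.IsNullField ι U ℓ) (hpU : p ∈ U) : g.expansion ι ℓ p = 0 := by
  obtain ⟨U', ℓ', hℓ', hpU', h0, hθ⟩ := hexp p
  obtain ⟨r, hr⟩ := hS.exists_smul h0 (hℓ'.null p hpU') (hℓ.null p hpU)
  rw [← mul_zero r, ← hθ]
  simp only [expansion, hS.derivTensor_eq_mul hℓ' hℓ hpU' hpU hr, mul_left_comm _ r,
    Finset.mul_sum]

lemma eventually_trace_eq (hS : g.IsNullSurface (d := d) ι) (hexp : g.IsNonExpanding (d := d) ι)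
    (hℓ : g.IsNullField ι U ℓ) (hpU : p ∈ U) (h0 : ℓ p ≠ 0)
    (hp : p ∈ (extChartAt (𝓡 d) p₀).source) (hc : ι p ∈ (extChartAt (𝓡 n) c).source)
    {W : 𝔼 d → 𝔼 d →L[ℝ] 𝔼 d} {κ : 𝔼 d → ℝ}
    (hW : IsWeingartenAt (g.connectionCoord c) (chartMap n d ι c p₀) (fieldCoord p₀ ℓ) W κ
      (extChartAt (𝓡 d) p₀ p)) :
    ∀ᶠ v in 𝓝 (extChartAt (𝓡 d) p₀ p), LinearMap.trace ℝ (𝔼 d) (W v) = κ v := by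
  have h_ne_zero := (hS.isDegenerateFieldAt hℓ hpU hp hc).eventually_ne_zero
    (fieldCoord_extChartAt_ne_zero hp h0)
  filter_upwards [hS.eventually_mem_chartDomain (extChartAt_mem_chartDomain hp hc),
    hℓ.eventually_mem hpU hp, hW.covAlong_eq, hW.apply_field, h_ne_zero]
    with v hv hvU hWv hκv hv0
  have hq := (extChartAt (𝓡 d) p₀).map_target hv.1
  have hv_eq := (extChartAt (𝓡 d) p₀).right_inv hv.1
  have hℓ0 : ℓ ((extChartAt (𝓡 d) p₀).symm v) ≠ 0 :=
    (map_ne_zero_iff _ (vecCoordEquiv hq).injective).1 hv0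
  have hθ := hS.expansion_eq_trace_sub_of_fieldDerivCoord_eq (W := W v) (κ := κ v) hℓ hvU hℓ0 hq
    hv.2 (by rw [hv_eq]; exact hWv) hκv
  rwa [hS.expansion_eq_zero hexp hℓ hvU, eq_comm, sub_eq_zero] at hθ

lemma derivTensor_eq_zero_and_ricci_eq_zero (hS : g.IsNullSurface (d := d) ι)
    (hnd : n = d + 1) (hexp : g.IsNonExpanding (d := d) ι) (hℓ : g.IsNullField ι U ℓ)
    (hpU : p ∈ U) (h0 : ℓ p ≠ 0)
    (hRic : 0 ≤ g.ricci (ι p) (mfderiv (𝓡 d) (𝓡 n) ι p (ℓ p))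
      (mfderiv (𝓡 d) (𝓡 n) ι p (ℓ p))) :
    (∀ X Y, g.derivTensor ι ℓ p X Y = 0) ∧
      g.ricci (ι p) (mfderiv (𝓡 d) (𝓡 n) ι p (ℓ p)) (mfderiv (𝓡 d) (𝓡 n) ι p (ℓ p)) = 0 := by
  have hp : p ∈ (extChartAt (𝓡 d) p).source := mem_extChartAt_source _
  have hc : ι p ∈ (extChartAt (𝓡 n) (ι p)).source := mem_extChartAt_source _
  have h := hS.isLorentzImmersionAt (extChartAt_mem_chartDomain hp hc)
  have hL := hS.isDegenerateFieldAt hℓ hpU hp hc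
  have hL0 : fieldCoord p ℓ (extChartAt (𝓡 d) p p) ≠ 0 := fieldCoord_extChartAt_ne_zero hp h0
  have hdim : finrank ℝ (𝔼 n) = finrank ℝ (𝔼 d) + 1 := by
    rw [finrank_euclideanSpace_fin, finrank_euclideanSpace_fin, hnd]
  obtain ⟨W, κ, hW⟩ := hL.exists_isWeingartenAt h hdim hL0
  have h_trace := hL.trace_jacobiOperator_nonpos h hdim hL0 hW
    (hS.eventually_trace_eq hexp hℓ hpU h0 hp hc hW)
  have h_point : chartMap n d ι (ι p) p (extChartAt (𝓡 d) p p) = extChartAt (𝓡 n) (ι p) (ι p) := by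
    rw [chartMap, (extChartAt (𝓡 d) p).left_inv hp]
  have h_ricci : LinearMap.trace ℝ (𝔼 n) (jacobiOperator (g.connectionCoord (ι p))
      (chartMap n d ι (ι p) p (extChartAt (𝓡 d) p p))
      (fderiv ℝ (chartMap n d ι (ι p) p) (extChartAt (𝓡 d) p p)
        (fieldCoord p ℓ (extChartAt (𝓡 d) p p))))
      = g.ricci (ι p) (mfderiv (𝓡 d) (𝓡 n) ι p (ℓ p)) (mfderiv (𝓡 d) (𝓡 n) ι p (ℓ p)) := by
    rw [h_point, fieldCoord_extChartAt hp, fderiv_chartMap_vecCoord hS.contMDiff hp hc,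
      g.ricci_self_eq_trace_jacobiOperator]
  rw [h_ricci] at h_trace
  have h_zero := le_antisymm h_trace.1 hRic
  refine ⟨fun X Y => ?_, h_zero⟩
  rw [hS.derivTensor_eq hℓ hpU hp hc]
  exact h_trace.2 h_zero _ _

end IsNullSurface

end LorentzMetric

end NonExpanding

theorem theorem1_general {n d : ℕ} (hnd : n = d + 1)
    {M : Type*} [TopologicalSpace M] [ChartedSpace (𝔼 n) M] [IsManifold (𝓡 n) ∞ M]
    (g : LorentzMetric n M) {S : Type*} [TopologicalSpace S] [ChartedSpace (𝔼 d) S]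
    [IsManifold (𝓡 d) ∞ S] (ι : S → M) (hnull : g.IsNullSurface (d := d) ι)
    (hexp : g.IsNonExpanding (d := d) ι)
    (hricci : ∀ (p : S) (v : TangentSpace (𝓡 d) p), g.induced ι p v v = 0 →
      0 ≤ g.ricci (ι p) (mfderiv (𝓡 d) (𝓡 n) ι p v) (mfderiv (𝓡 d) (𝓡 n) ι p v)) :
    (∀ (U : Set S) (ℓ : ∀ p : S, TangentSpace (𝓡 d) p), g.IsNullField ι U ℓ →
      ∀ p ∈ U, ∀ X Y : TangentSpace (𝓡 d) p, g.derivTensor ι ℓ p X Y = 0) ∧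
    (∀ (U : Set S) (ℓ : ∀ p : S, TangentSpace (𝓡 d) p), g.IsNullField ι U ℓ →
      ∀ p ∈ U, ∀ X Y : TangentSpace (𝓡 d) p, lieDerivForm (g.induced ι) ℓ p X Y = 0) ∧
    (∀ (p : S) (v : TangentSpace (𝓡 d) p), g.induced ι p v v = 0 →
      g.ricci (ι p) (mfderiv (𝓡 d) (𝓡 n) ι p v) (mfderiv (𝓡 d) (𝓡 n) ι p v) = 0) := by
  have h_shear_free : ∀ (U : Set S) (ℓ : ∀ p : S, TangentSpace (𝓡 d) p), g.IsNullField ι U ℓ →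
      ∀ p ∈ U, ∀ X Y : TangentSpace (𝓡 d) p, g.derivTensor ι ℓ p X Y = 0 := by
    intro U ℓ hℓ p hp X Y
    obtain ⟨U', ℓ', hℓ', hp', h0, -⟩ := hexp p
    obtain ⟨r, hr⟩ := hnull.exists_smul h0 (hℓ'.null p hp') (hℓ.null p hp)
    rw [hnull.derivTensor_eq_mul hℓ' hℓ hp' hp hr, (hnull.derivTensor_eq_zero_and_ricci_eq_zero hnd
      hexp hℓ' hp' h0 (hricci p _ (hℓ'.null p hp'))).1, mul_zero]
  refine ⟨h_shear_free, fun U ℓ hℓ p hp X Y => ?_, fun p v hv => ?_⟩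
  · rw [hnull.lieDerivForm_eq_two_mul hℓ hp, h_shear_free U ℓ hℓ p hp, mul_zero]
  · obtain ⟨U', ℓ', hℓ', hp', h0, -⟩ := hexp p
    obtain ⟨r, rfl⟩ := hnull.exists_smul h0 (hℓ'.null p hp') hv
    rw [map_smul, g.ricci_smul_self, (hnull.derivTensor_eq_zero_and_ricci_eq_zero hnd hexp hℓ' hp'
      h0 (hricci p _ (hℓ'.null p hp'))).2, mul_zero]

theorem theorem1 {n : ℕ} (hn : 2 < n)
    {M : Type*} [TopologicalSpace M] [ChartedSpace (EuclideanSpace ℝ (Fin n)) M]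
    [IsManifold (𝓡 n) ∞ M] (g : LorentzMetric n M)
    {S : Type*} [TopologicalSpace S] [ChartedSpace (EuclideanSpace ℝ (Fin (n - 1))) S]
    [IsManifold (𝓡 (n - 1)) ∞ S] (ι : S → M)
    (hnull : g.IsNullSurface (d := n - 1) ι)
    (hexp : g.IsNonExpanding (d := n - 1) ι)
    (Λ : ℝ) (T : ∀ x : M, TangentSpace (𝓡 n) x →L[ℝ] TangentSpace (𝓡 n) x →L[ℝ] ℝ)
    (hEinstein : ∀ (p : S) (v w : TangentSpace (𝓡 n) (ι p)),
      g.einstein (ι p) v w = -Λ * g.val (ι p) v w + T (ι p) v w)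
    (henergy : ∀ (p : S) (v : TangentSpace (𝓡 (n - 1)) p), g.induced ι p v v = 0 →
      0 ≤ T (ι p) (mfderiv (𝓡 (n - 1)) (𝓡 n) ι p v) (mfderiv (𝓡 (n - 1)) (𝓡 n) ι p v)) :
    (∀ (U : Set S) (ℓ : ∀ p : S, TangentSpace (𝓡 (n - 1)) p), g.IsNullField ι U ℓ →
      ∀ p ∈ U, ∀ X Y : TangentSpace (𝓡 (n - 1)) p, g.derivTensor ι ℓ p X Y = 0) ∧
    (∀ (U : Set S) (ℓ : ∀ p : S, TangentSpace (𝓡 (n - 1)) p), g.IsNullField ι U ℓ →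
      ∀ p ∈ U, ∀ X Y : TangentSpace (𝓡 (n - 1)) p,
        lieDerivForm (g.induced ι) ℓ p X Y = 0) ∧
    (∀ (p : S) (v : TangentSpace (𝓡 (n - 1)) p), g.induced ι p v v = 0 →
      g.ricci (ι p) (mfderiv (𝓡 (n - 1)) (𝓡 n) ι p v)
        (mfderiv (𝓡 (n - 1)) (𝓡 n) ι p v) = 0) :=
  theorem1_general (by omega) g ι hnull hexp fun p v hv =>
    (henergy p v hv).trans_eq (g.ricci_self_eq_of_einstein_eq _ hv (hEinstein p _ _)).symm
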